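/- Let $n\ge 2$, let $\mathbb S$ be the unit sphere of $\mathbb R^n$ with the uniform measure $\mathrm d\omega$ of total mass $1$, and let $\sigma>0$. For a function $f$ on $\mathbb S$ (or, with $f\,\mathrm d\omega$ replaced by $\mathrm d\nu$, a measure $\nu$ on $\mathbb S$) put $J[f]=\int_{\mathbb S}\omega f(\omega)\,\mathrm d\omega$. With $\nabla_\omega$, $\nabla_\omega\cdot$, $\Delta_\omega$ the gradient, divergence and Laplace–Beltrami operator of $\mathbb S$, define $$Q(f)=-\nabla_\omega\cdot\big((\mathrm{Id}-\omega\otimes\omega)J[f]\,f\big)+\sigma\Delta_\omega f,$$ $$\mathcal F(f)=\sigma\int_{\mathbb S}f\ln f\,\mathrm d\omega-\tfrac12|J[f]|^2,\qquad \mathcal D(f)=\int_{\mathbb S}f\,\big|\nabla_\omega(\sigma\ln f-\omega\cdot J[f])\big|^2\,\mathrm d\omega\in[0,\infty],$$ where the integrand of $\mathcal D(f)$ is read as $0$ where $f=0$. A steady state of the Doi equation $\partial_t f=Q(f)$ is a probability measure $\nu$ on $\mathbb S$ that is a weak solution independent of time; a weak solution $(\nu_t)_{t\ge0}$ satisfies,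 for all $h\in C^\infty(\mathbb S)$ and $t\ge 0$, $$\int_{\mathbb S} h\,\mathrm d\nu_t-\int_{\mathbb S} h\,\mathrm d\nu_0=\int_0^t\Big(\sigma\int_{\mathbb S}\Delta_\omega h\,\mathrm d\nu_\tau+\int_{\mathbb S}J[\nu_\tau]\cdot\nabla_\omega h\,\mathrm d\nu_\tau\Big)\mathrm d\tau .$$ Then for every probability measure $\nu$ on $\mathbb S$ the following are equivalent: 0. $\nu$ is a steady state of the Doi equation. 1. $\nu$ has a density $f\ge0$ with $f\in C^2(\mathbb S)$ and $Q(f)=0$. 2. $\nu$ has a density $f\ge0$ with $f\in C^1(\mathbb S)$ and $\mathcal D(f)=0$. 3. $\nu$ has a density $f\in C^0(\mathbb S)$ that is positive everywhere and is a critical point of $\mathcal F$ under the constraint $\int_{\mathbb S}f\,\mathrm d\omega=1$, that is, $\mathcal F(f+h)=\mathcal F(f)+o(\|h\|_\infty)$ as $\|h\|_\infty\to0$, for $h\in C^0(\mathbb S)$ with $\int_{\mathbb S}h\,\mathrm d\omega=0$. 4. $\nu$ has a positive density $f$ for which there is $C\in\mathbb R$ with $\sigma\ln f(\omega)-J[f]\cdot\omega=C$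 for all $\omega\in\mathbb S$. -/

import Mathlib

open MeasureTheory Metric
open scoped Manifold InnerProductSpace

namespace Doi

/-- The Euclidean space of dimension `n = d + 1`. -/
abbrev E (d : ℕ) : Type := EuclideanSpace ℝ (Fin (d + 1))

/-- The unit sphere of the Euclidean space of dimension `n = d + 1`. -/
abbrev S (d : ℕ) : Type := sphere (0 : E d) 1

/-- The uniform measure on the sphere, of total mass one (normalized surface measure). -/
noncomputable def unif (d : ℕ) : Measure (S d) :=
  ((volume : Measure (E d)).toSphere Set.univ)⁻¹ • (volume : Measure (E d)).toSphere

theorem unif_univ (d : ℕ) : unif d Set.univ = 1 := by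
  have h0 : (volume : Measure (E d)).toSphere Set.univ ≠ 0 := by
    rw [Measure.toSphere_apply_univ]
    refine mul_ne_zero ?_ (measure_ball_pos _ _ one_pos).ne'
    simp
  simp only [unif, Measure.smul_apply, smul_eq_mul]
  exact ENNReal.inv_mul_cancel h0 (measure_ne_top _ _)

instance (d : ℕ) : IsProbabilityMeasure (unif d) := ⟨unif_univ d⟩

section Calculus

variable {d : ℕ}

/-- Extension of a map on the sphere to the ambient space, constant along rays:
`x ↦ g (x / |x|)` for `x ≠ 0` (the value at the origin plays no role). -/
noncomputable def radialExt {F : Type} [Zero F] (g : S d → F) (x : E d) : F :=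
  if hx : x = 0 then 0
  else g ⟨‖x‖⁻¹ • x, by
    rw [mem_sphere_zero_iff_norm, norm_smul, norm_inv, norm_norm,
      inv_mul_cancel₀ (norm_ne_zero_iff.mpr hx)]⟩

/-- Tangential gradient on the unit sphere: on the sphere it is the Euclidean gradient of the
extension that is constant along rays. -/
noncomputable def sphGrad (f : S d → ℝ) (ω : S d) : E d :=
  gradient (radialExt f) (ω : E d)

/-- Divergence on the unit sphere of a tangent vector field: on the sphere it is the Euclidean
divergence of the extension that is constant along rays. -/
noncomputable def sphDiv (A : S d → E d) (ω : S d) : ℝ :=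
  LinearMap.trace ℝ (E d) (fderiv ℝ (radialExt A) (ω : E d)).toLinearMap

/-- The Laplace–Beltrami operator on the unit sphere. -/
noncomputable def sphLaplacian (f : S d → ℝ) (ω : S d) : ℝ :=
  sphDiv (sphGrad f) ω

/-- Orthogonal projection `(Id - ω ⊗ ω) V` of `V` on the tangent space of the sphere at `ω`. -/
noncomputable def tangProj (ω : S d) (V : E d) : E d :=
  V - ⟪(ω : E d), V⟫_ℝ • (ω : E d)

/-- `f` is of class `C^k` on the sphere, as a manifold; `k : ℕ∞`, so that `⊤` means smooth. -/
def IsC (k : ℕ∞) (f : S d → ℝ) : Prop :=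
  ContMDiff (𝓡 d) 𝓘(ℝ, ℝ) (k : WithTop ℕ∞) f

end Calculus

section Model

variable {d : ℕ}

/-- First moment `J[f] = ∫ ω f(ω) dω` of a function. -/
noncomputable def J (f : S d → ℝ) : E d := ∫ ω, f ω • (ω : E d) ∂(unif d)

/-- First moment `∫ ω dν(ω)` of a measure. -/
noncomputable def JMeas (ν : Measure (S d)) : E d := ∫ ω, (ω : E d) ∂ν

/-- `Q(f) = - ∇ · ((Id - ω ⊗ ω) J[f] f) + σ Δ f`. -/
noncomputable def Q (σ : ℝ) (f : S d → ℝ) (ω : S d) : ℝ :=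
  - sphDiv (fun η => f η • tangProj η (J f)) ω + σ * sphLaplacian f ω

/-- The chemical potential `σ ln f - ω · J[f]`. -/
noncomputable def chemPot (σ : ℝ) (f : S d → ℝ) (ω : S d) : ℝ :=
  σ * Real.log (f ω) - ⟪(ω : E d), J f⟫_ℝ

/-- The free energy `σ ∫ f ln f - |J[f]|² / 2`. -/
noncomputable def freeEnergy (σ : ℝ) (f : S d → ℝ) : ℝ :=
  σ * (∫ ω, f ω * Real.log (f ω) ∂(unif d)) - ‖J f‖ ^ 2 / 2

/-- The dissipation `∫ f |∇ (σ ln f - ω · J[f])|²`, with values in `[0, ∞]`. For nonnegative `f`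
the integrand is `0` where `f` vanishes, so only the open set `{f > 0}` contributes. -/
noncomputable def dissipation (σ : ℝ) (f : S d → ℝ) : ENNReal :=
  ∫⁻ ω, ENNReal.ofReal (f ω * ‖sphGrad (chemPot σ f) ω‖ ^ 2) ∂(unif d)

/-- `f` is a (nonnegative, everywhere defined) density of `ν` with respect to the uniform
measure. -/
def IsDensity (f : S d → ℝ) (ν : Measure (S d)) : Prop :=
  Measurable f ∧ (∀ ω, 0 ≤ f ω) ∧ ν = (unif d).withDensity (fun ω => ENNReal.ofReal (f ω))

/-- Continuous functions on the sphere with mean zero, a subspace of the Banach space `C⁰` with the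
sup norm: the directions that keep the constraint `∫ f = 1`. -/
noncomputable def meanZero (d : ℕ) : Submodule ℝ C(S d, ℝ) where
  carrier := {h | ∫ ω, h ω ∂(unif d) = 0}
  zero_mem' := by simp
  add_mem' := by
    intro a b ha hb
    simp only [Set.mem_ofPred_eq, ContinuousMap.add_apply] at *
    rw [integral_add (a.continuous.integrable_of_hasCompactSupport (HasCompactSupport.of_compactSpace _))
      (b.continuous.integrable_of_hasCompactSupport (HasCompactSupport.of_compactSpace _)), ha, hb,
      add_zero]
  smul_mem' := by
    intro c a ha
    simp only [Set.mem_ofPred_eq, ContinuousMap.smul_apply, smul_eq_mul] at *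
    rw [integral_const_mul, ha, mul_zero]

/-- `f` is a critical point of the free energy under the constraint of mean one: `∫ f = 1`, and the
differential at `f` of the free energy along the affine space `f + meanZero` exists and vanishes,
i.e. `freeEnergy (f + h) = freeEnergy f + o(‖h‖_∞)` for `h` continuous with mean zero. -/
def IsConstrainedCritical (σ : ℝ) (f : S d → ℝ) : Prop :=
  (∫ ω, f ω ∂(unif d) = 1) ∧
    HasFDerivAt (fun h : meanZero d => freeEnergy σ (fun ω => f ω + (h : C(S d, ℝ)) ω))
      (0 : meanZero d →L[ℝ] ℝ) 0

/-- The right-hand side of the Doi equation, tested against `h`: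
`σ ∫ Δh dν + ∫ J[ν] · ∇h dν`, that is, `- σ ⟨∇ν, ∇h⟩ + ⟨ν, J[ν] · ∇h⟩`
with `∇ν` in the sense of distributions. -/
noncomputable def weakRhs (σ : ℝ) (ν : Measure (S d)) (h : S d → ℝ) : ℝ :=
  σ * (∫ ω, sphLaplacian h ω ∂ν) + ∫ ω, ⟪JMeas ν, sphGrad h ω⟫_ℝ ∂ν

/-- A curve `t ↦ ν t` (`t ≥ 0`) of measures on the sphere is a weak solution of the Doi equation
`∂ₜ f = Q(f)`: for every smooth test function `h`, the function `t ↦ ∫ h dν t` is an indefinite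
integral of `t ↦ weakRhs σ (ν t) h`. -/
def IsWeakSolution (σ : ℝ) (ν : ℝ → Measure (S d)) : Prop :=
  ∀ h : S d → ℝ, IsC ⊤ h → ∀ t : ℝ, 0 ≤ t →
    IntervalIntegrable (fun τ => weakRhs σ (ν τ) h) volume 0 t ∧
      ∫ ω, h ω ∂(ν t) - ∫ ω, h ω ∂(ν 0) = ∫ τ in (0 : ℝ)..t, weakRhs σ (ν τ) h

/-- A steady state is a probability measure which, as a curve that does not depend on time, is a
weak solution of the Doi equation. -/
def IsSteadyState (σ : ℝ) (ν : Measure (S d)) : Prop :=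
  IsProbabilityMeasure ν ∧ IsWeakSolution σ (fun _ : ℝ => ν)

end Model

end Doi

namespace Doi

open Filter

variable {d : ℕ}

/-! Everything is compared with the last condition, which says that `f` is proportional to `exp (ω ·
J / σ)` with `J = J[f]`. For such an `f` the flux `σ ∇f - f (Id - ω ⊗ ω) J` vanishes identically,
hence so do `Q(f)` and the dissipation, and the differential of the free energy, which is
integration against the chemical potential, vanishes on functions of mean zero. Green's formulas,
which rest on `integral_pd`, turn `Q(f) = 0` into the weak equation.

Two of the converses are short. Zero dissipation forces `f exp (-ω · J / σ)` to be constant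
(`exists_chemPot_eq_of_dissipation_eq_zero`). At a critical point one tests the differential with
the chemical potential minus its mean (`isConstrainedCritical_iff`).

The main difficulty is that a steady state is only a measure. Freezing `v = J[ν]` makes the equation
linear: `ν` annihilates `σ Δh + v · ∇h` for all smooth `h`. Let `g` be the component of `ν` of
degree `l` in spherical harmonics, and take `h = g`. The Laplacian contributes `σ l (l + d - 1)
‖g‖²`, while the drift costs one factor of order `l` and sees only the components of degrees `l -
1`, `l`, `l + 1`. Each use of this recurrence (`norm_harm_recurrence`) gains a factor `1 / l`, so
the components decay like `C ^ l / l!` (`norm_harm_decay`). Sup norms of polynomials of degree `l`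
exceed their `L²` norms by at most an exponential in `l` (`abs_apply_le_of_mem_pol`), so the
expansion converges uniformly with its gradient and `ν` has a continuous density `f`. With `M = exp
(ω · v / σ)` and `u = f / M` the equation becomes `∫ M ∇u · ∇h = 0`; letting `h` tend to `u` gives
`∇u = 0` (`exists_density_eq_exp`).

Harmonics enter through the filtration `pol` by degree, on which the Laplacian is triangular
(`Lap_add_mem_pol`). The assumption `d ≥ 1` makes the sphere connected and the eigenvalues at least
`l²`. -/

theorem fact_finrank (d : ℕ) : Fact (Module.finrank ℝ (E d) = d + 1) :=
  ⟨finrank_euclideanSpace_fin⟩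

theorem contMDiff_coe (k : WithTop ℕ∞) :
    ContMDiff (𝓡 d) 𝓘(ℝ, E d) k ((↑) : S d → E d) :=
  haveI := fact_finrank d
  contMDiff_coe_sphere (n := d)

theorem inner_single_one (x : E d) (i : Fin (d + 1)) :
    ⟪x, EuclideanSpace.single i (1 : ℝ)⟫_ℝ = x i := by
  rw [EuclideanSpace.inner_single_right]; simp

/-! ### Radial extensions -/

/-- The point `x / |x|` of the sphere. -/
noncomputable def toS (x : E d) (hx : x ≠ 0) : S d :=
  ⟨‖x‖⁻¹ • x, by
    rw [mem_sphere_zero_iff_norm, norm_smul, norm_inv, norm_norm,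
      inv_mul_cancel₀ (norm_ne_zero_iff.mpr hx)]⟩

theorem coe_ne_zero (ω : S d) : (ω : E d) ≠ 0 := ne_zero_of_mem_unit_sphere ω

theorem norm_coe_S (ω : S d) : ‖(ω : E d)‖ = 1 := norm_eq_of_mem_sphere ω

theorem toS_coe (ω : S d) : toS (ω : E d) (coe_ne_zero ω) = ω := by
  ext1; simp [toS]

theorem toS_smul {x : E d} (hx : x ≠ 0) {c : ℝ} (hc : 0 < c) :
    toS (c • x) (smul_ne_zero hc.ne' hx) = toS x hx := by
  ext1
  simp only [toS, norm_smul, Real.norm_of_nonneg hc.le, smul_smul]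
  congr 1
  field_simp

theorem radialExt_of_ne {F : Type} [Zero F] (g : S d → F) {x : E d} (hx : x ≠ 0) :
    radialExt g x = g (toS x hx) := by
  simp [radialExt, hx, toS]

theorem radialExt_coe {F : Type} [Zero F] (g : S d → F) (ω : S d) :
    radialExt g (ω : E d) = g ω := by
  rw [radialExt_of_ne g (coe_ne_zero ω), toS_coe]

theorem radialExt_smul {F : Type} [Zero F] (g : S d → F) (x : E d) {c : ℝ} (hc : 0 < c) :
    radialExt g (c • x) = radialExt g x := by
  by_cases hx : x = 0
  · simp [hx]
  · rw [radialExt_of_ne g hx, radialExt_of_ne g (smul_ne_zero hc.ne' hx), toS_smul hx hc]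

theorem eventually_ne_zero (ω : S d) : ∀ᶠ x in nhds (ω : E d), x ≠ 0 :=
  isOpen_ne.mem_nhds (coe_ne_zero ω)

/-- A function is of class `C^k` on the sphere if and only if its radial extension is of class `C^k`
away from the origin. -/
theorem isC_iff {k : ℕ∞} {f : S d → ℝ} :
    IsC k f ↔ ContDiffOn ℝ k (radialExt f) {0}ᶜ := by
  constructor
  · intro hf
    let U : TopologicalSpace.Opens (E d) := ⟨{0}ᶜ, isOpen_compl_singleton⟩
    have h1 : ContMDiff 𝓘(ℝ, E d) 𝓘(ℝ, E d) (k : WithTop ℕ∞)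
        (fun x : U => ‖(x : E d)‖⁻¹ • (x : E d)) := by
      intro x
      refine contMDiffAt_subtype_iff (f := fun x : E d => ‖x‖⁻¹ • x) |>.mpr ?_
      have hx : (x : E d) ≠ 0 := x.2
      exact (((contDiffAt_norm ℝ hx).inv (norm_ne_zero_iff.mpr hx)).smul contDiffAt_id).contMDiffAt
    have := fact_finrank d
    have h2 := h1.codRestrict_sphere (n := d) (fun x => (toS (x : E d) x.2).2)
    have h3 : ContMDiff 𝓘(ℝ, E d) 𝓘(ℝ, ℝ) (k : WithTop ℕ∞) (fun x : U => radialExt f x) := by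
      convert! hf.comp h2 using 1
      ext x
      exact radialExt_of_ne f x.2
    intro x hx
    have h4 := h3 ⟨x, hx⟩
    exact ((contMDiffAt_subtype_iff (f := radialExt f)).mp h4).contDiffAt.contDiffWithinAt
  · intro hf
    have h1 : (fun ω : S d => radialExt f (ω : E d)) = f := funext (radialExt_coe f)
    have h2 : ContMDiff (𝓡 d) 𝓘(ℝ, ℝ) (k : WithTop ℕ∞) (fun ω : S d => radialExt f (ω : E d)) := by
      intro ω
      have h3 : ContDiffAt ℝ k (radialExt f) (ω : E d) :=
        hf.contDiffAt (isOpen_compl_singleton.mem_nhds (coe_ne_zero ω))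
      exact ContMDiffAt.comp ω h3.contMDiffAt (contMDiff_coe _ ω)
    rwa [h1] at h2

theorem IsC.contDiffAt {k : ℕ∞} {f : S d → ℝ} (hf : IsC k f) {x : E d} (hx : x ≠ 0) :
    ContDiffAt ℝ k (radialExt f) x :=
  (isC_iff.mp hf).contDiffAt (isOpen_compl_singleton.mem_nhds hx)

theorem IsC.of_le {k l : ℕ∞} {f : S d → ℝ} (hf : IsC k f) (h : l ≤ k) : IsC l f :=
  ContMDiff.of_le hf (by exact_mod_cast h)

theorem IsC.continuous {k : ℕ∞} {f : S d → ℝ} (hf : IsC k f) : Continuous f :=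
  ContMDiff.continuous hf

/-- Differentiability of a function on the sphere at a point. -/
def DiffAt (f : S d → ℝ) (ω : S d) : Prop := DifferentiableAt ℝ (radialExt f) (ω : E d)

theorem IsC.diffAt {k : ℕ∞} {f : S d → ℝ} (hf : IsC k f) (hk : 1 ≤ k) (ω : S d) : DiffAt f ω :=
  (hf.contDiffAt (coe_ne_zero ω)).differentiableAt (by
    have : (1 : WithTop ℕ∞) ≤ k := by exact_mod_cast hk
    exact (lt_of_lt_of_le one_pos this).ne')

theorem isC_comp {k : ℕ∞} {f : S d → ℝ} (hf : IsC k f) {φ : ℝ → ℝ}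
    (hφ : ∀ ω, ContDiffAt ℝ k φ (f ω)) : IsC k (fun ω => φ (f ω)) := by
  intro ω
  exact (hφ ω).contMDiffAt.comp ω (hf ω)

theorem isC_const (k : ℕ∞) (c : ℝ) : IsC k (fun _ : S d => c) := contMDiff_const

theorem IsC.add {k : ℕ∞} {f g : S d → ℝ} (hf : IsC k f) (hg : IsC k g) :
    IsC k (fun ω => f ω + g ω) := ContMDiff.add hf hg

theorem IsC.sub {k : ℕ∞} {f g : S d → ℝ} (hf : IsC k f) (hg : IsC k g) :
    IsC k (fun ω => f ω - g ω) := ContMDiff.sub hf hg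

theorem IsC.mul {k : ℕ∞} {f g : S d → ℝ} (hf : IsC k f) (hg : IsC k g) :
    IsC k (fun ω => f ω * g ω) := ContMDiff.mul hf hg

theorem isC_inner (k : ℕ∞) (v : E d) : IsC k (fun ω : S d => ⟪(ω : E d), v⟫_ℝ) := by
  have h : ContDiff ℝ k (fun x : E d => ⟪x, v⟫_ℝ) := contDiff_id.inner ℝ contDiff_const
  exact h.contMDiff.comp (contMDiff_coe _)

/-- The coordinate functions on the sphere. -/
def coord (i : Fin (d + 1)) (ω : S d) : ℝ := (ω : E d) i

theorem coord_eq_inner (i : Fin (d + 1)) (ω : S d) :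
    coord i ω = ⟪(ω : E d), EuclideanSpace.single i 1⟫_ℝ :=
  (inner_single_one _ i).symm

theorem isC_coord (k : ℕ∞) (i : Fin (d + 1)) : IsC k (coord (d := d) i) := by
  have : coord (d := d) i = fun ω : S d => ⟪(ω : E d), EuclideanSpace.single i 1⟫_ℝ :=
    funext (coord_eq_inner i)
  rw [this]
  exact isC_inner k _

/-! ### Partial derivatives -/

/-- The `i`-th Cartesian component of the tangential gradient. -/
noncomputable def pd (i : Fin (d + 1)) (f : S d → ℝ) (ω : S d) : ℝ :=
  fderiv ℝ (radialExt f) (ω : E d) (EuclideanSpace.single i 1)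

theorem sphGrad_apply (f : S d → ℝ) (ω : S d) (i : Fin (d + 1)) : sphGrad f ω i = pd i f ω := by
  have h : ⟪sphGrad f ω, EuclideanSpace.single i 1⟫_ℝ = pd i f ω := by
    simp only [sphGrad, gradient, pd]
    exact InnerProductSpace.toDual_symm_apply
  rwa [inner_single_one] at h

theorem inner_sphGrad (f : S d → ℝ) (ω : S d) (v : E d) :
    ⟪v, sphGrad f ω⟫_ℝ = ∑ i, v i * pd i f ω := by
  simp [PiLp.inner_apply, sphGrad_apply, mul_comm]

theorem norm_sq_sphGrad (f : S d → ℝ) (ω : S d) : ‖sphGrad f ω‖ ^ 2 = ∑ i, pd i f ω ^ 2 := by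
  simp [EuclideanSpace.norm_sq_eq, sphGrad_apply]

theorem fderiv_radialExt_smul (f : S d → ℝ) (x : E d) {c : ℝ} (hc : 0 < c) :
    fderiv ℝ (radialExt f) (c • x) = c⁻¹ • fderiv ℝ (radialExt f) x := by
  have h1 : (fun y => radialExt f (c • y)) = radialExt f :=
    funext fun y => radialExt_smul f y hc
  have h2 := fderiv_comp_smul (𝕜 := ℝ) (f := radialExt f) c (x := x)
  rw [h1] at h2
  rw [h2, smul_smul, inv_mul_cancel₀ hc.ne', one_smul]

theorem fderiv_radialExt_of_ne (f : S d → ℝ) {x : E d} (hx : x ≠ 0) :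
    fderiv ℝ (radialExt f) x = ‖x‖⁻¹ • fderiv ℝ (radialExt f) (toS x hx : E d) := by
  have h := fderiv_radialExt_smul f x (c := ‖x‖⁻¹) (by positivity)
  have h2 : ((toS x hx : S d) : E d) = ‖x‖⁻¹ • x := rfl
  rw [h2, h, inv_inv, smul_smul, inv_mul_cancel₀ (norm_ne_zero_iff.mpr hx), one_smul]

theorem fderiv_radialExt_apply (f : S d → ℝ) {x : E d} (hx : x ≠ 0) (i : Fin (d + 1)) :
    fderiv ℝ (radialExt f) x (EuclideanSpace.single i 1) = ‖x‖⁻¹ * radialExt (pd i f) x := by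
  rw [fderiv_radialExt_of_ne f hx, radialExt_of_ne _ hx]
  rfl

/-- The derivative of a radial extension is homogeneous of degree `-1`, so multiplying it by `‖x‖`
gives the radial extension of `pd i f`; smoothness can then be read off in the ambient space. -/
theorem isC_pd {k l : ℕ∞} {f : S d → ℝ} (hf : IsC k f) (h : l + 1 ≤ k) (i : Fin (d + 1)) :
    IsC l (pd i f) := by
  rw [isC_iff]
  intro x hx
  have hx : x ≠ 0 := hx
  have h1 : ContDiffAt ℝ l (fderiv ℝ (radialExt f)) x :=
    (hf.contDiffAt hx).fderiv_right (by exact_mod_cast h)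
  have h2 : ContDiffAt ℝ l
      (fun y => ‖y‖ * fderiv ℝ (radialExt f) y (EuclideanSpace.single i 1)) x :=
    (contDiffAt_norm ℝ hx).mul (h1.clm_apply contDiffAt_const)
  refine (h2.congr_of_eventuallyEq ?_).contDiffWithinAt
  filter_upwards [isOpen_ne.mem_nhds hx] with y hy
  rw [fderiv_radialExt_apply f hy, mul_inv_cancel_left₀ (norm_ne_zero_iff.mpr hy)]

theorem isC_pd_top {f : S d → ℝ} (hf : IsC ⊤ f) (i : Fin (d + 1)) : IsC ⊤ (pd i f) :=
  isC_pd hf (by simp) i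

theorem pd_const (i : Fin (d + 1)) (c : ℝ) (ω : S d) : pd i (fun _ => c) ω = 0 := by
  have h : radialExt (fun _ : S d => c) =ᶠ[nhds (ω : E d)] fun _ => c := by
    filter_upwards [eventually_ne_zero ω] with y hy
    rw [radialExt_of_ne _ hy]
  simp [pd, h.fderiv_eq]

theorem pd_add {f g : S d → ℝ} {ω : S d} (hf : DiffAt f ω) (hg : DiffAt g ω) (i : Fin (d + 1)) :
    pd i (fun η => f η + g η) ω = pd i f ω + pd i g ω := by
  have h : radialExt (fun η => f η + g η) =ᶠ[nhds (ω : E d)] radialExt f + radialExt g := by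
    filter_upwards [eventually_ne_zero ω] with y hy
    simp [radialExt_of_ne _ hy]
  simp only [pd, h.fderiv_eq]
  rw [fderiv_add hf hg]; rfl

theorem pd_mul {f g : S d → ℝ} {ω : S d} (hf : DiffAt f ω) (hg : DiffAt g ω) (i : Fin (d + 1)) :
    pd i (fun η => f η * g η) ω = f ω * pd i g ω + g ω * pd i f ω := by
  have h : radialExt (fun η => f η * g η) =ᶠ[nhds (ω : E d)] radialExt f * radialExt g := by
    filter_upwards [eventually_ne_zero ω] with y hy
    simp [radialExt_of_ne _ hy]
  simp only [pd, h.fderiv_eq]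
  rw [fderiv_mul hf hg]
  simp [radialExt_coe]

theorem pd_comp {f : S d → ℝ} {ω : S d} (hf : DiffAt f ω) {φ : ℝ → ℝ} {φ' : ℝ}
    (hφ : HasDerivAt φ φ' (f ω)) (i : Fin (d + 1)) :
    DiffAt (fun η => φ (f η)) ω ∧ pd i (fun η => φ (f η)) ω = φ' * pd i f ω := by
  have h : radialExt (fun η => φ (f η)) =ᶠ[nhds (ω : E d)] φ ∘ radialExt f := by
    filter_upwards [eventually_ne_zero ω] with y hy
    simp [radialExt_of_ne _ hy]
  have hφ' : HasDerivAt φ φ' (radialExt f (ω : E d)) := by rwa [radialExt_coe]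
  have h2 := hφ'.comp_hasFDerivAt (ω : E d) hf.hasFDerivAt
  refine ⟨h2.differentiableAt.congr_of_eventuallyEq h, ?_⟩
  simp only [pd, h.fderiv_eq]
  rw [h2.fderiv]; rfl

theorem pd_const_mul {f : S d → ℝ} {ω : S d} (hf : DiffAt f ω) (c : ℝ) (i : Fin (d + 1)) :
    pd i (fun η => c * f η) ω = c * pd i f ω :=
  (pd_comp hf (φ := fun t => c * t) (by simpa using (hasDerivAt_id (f ω)).const_mul c) i).2

theorem pd_sub {f g : S d → ℝ} {ω : S d} (hf : DiffAt f ω) (hg : DiffAt g ω) (i : Fin (d + 1)) :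
    pd i (fun η => f η - g η) ω = pd i f ω - pd i g ω := by
  have h : radialExt (fun η => f η - g η) =ᶠ[nhds (ω : E d)] radialExt f - radialExt g := by
    filter_upwards [eventually_ne_zero ω] with y hy
    simp [radialExt_of_ne _ hy]
  simp only [pd, h.fderiv_eq]
  rw [fderiv_sub hf hg]; rfl

/-- The radial extension is `⟪x, v⟫ / ‖x‖`; the normalization produces the second term, so that the
gradient is the tangential part of `v`. -/
theorem pd_inner (v : E d) (i : Fin (d + 1)) (ω : S d) :
    pd i (fun η : S d => ⟪(η : E d), v⟫_ℝ) ω = v i - ⟪(ω : E d), v⟫_ℝ * coord i ω := by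
  have h : radialExt (fun η : S d => ⟪(η : E d), v⟫_ℝ) =ᶠ[nhds (ω : E d)]
      fun x => ‖x‖⁻¹ * ⟪x, v⟫_ℝ := by
    filter_upwards [eventually_ne_zero ω] with y hy
    rw [radialExt_of_ne _ hy, toS, real_inner_smul_left]
  have h0 := coe_ne_zero ω
  have hn : HasFDerivAt (fun x : E d => ‖x‖) (innerSL ℝ (ω : E d)) (ω : E d) := by
    have h1 := (hasStrictFDerivAt_norm_sq (ω : E d)).hasFDerivAt.sqrt (by simp)
    simp only [norm_nonneg, Real.sqrt_sq, norm_coe_S] at h1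
    have h2 : innerSL ℝ (ω : E d) = (1 / (2 * √(1 ^ 2)) : ℝ) • 2 • innerSL ℝ (ω : E d) := by
      ext x
      simp
    rw [h2]
    exact h1
  have hi : HasDerivAt (fun t : ℝ => t⁻¹) (-1) ‖(ω : E d)‖ := by
    rw [norm_coe_S]; simpa using hasDerivAt_inv (one_ne_zero (α := ℝ))
  have hv : HasFDerivAt (fun x : E d => ⟪x, v⟫_ℝ) (innerSL ℝ v) (ω : E d) := by
    have := (innerSL ℝ v).hasFDerivAt (x := (ω : E d))
    convert! this using 1
    ext x
    simp [real_inner_comm]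
  have h2 := (hi.comp_hasFDerivAt (ω : E d) hn).mul hv
  simp only [pd, h.fderiv_eq]
  have h3 : fderiv ℝ (fun x : E d => ‖x‖⁻¹ * ⟪x, v⟫_ℝ) (ω : E d) = _ := h2.fderiv
  rw [h3]
  simp [coord, inner_single_one]
  ring

theorem pd_coord (i j : Fin (d + 1)) (ω : S d) :
    pd i (coord j) ω = (if i = j then 1 else 0) - coord j ω * coord i ω := by
  have : coord (d := d) j = fun ω : S d => ⟪(ω : E d), EuclideanSpace.single j 1⟫_ℝ :=
    funext (coord_eq_inner j)
  rw [this, pd_inner]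
  simp [coord]

theorem sum_coord_sq (ω : S d) : ∑ i, coord i ω * coord i ω = 1 := by
  have h := EuclideanSpace.norm_sq_eq (ω : E d)
  rw [norm_coe_S] at h
  simp only [Real.norm_eq_abs, sq_abs, one_pow] at h
  rw [h]
  exact Finset.sum_congr rfl fun i _ => (pow_two _).symm

theorem sum_smul_single (x : E d) : ∑ i, x i • EuclideanSpace.single i (1 : ℝ) = x := by
  ext j
  simp [Pi.single_apply]

theorem fderiv_radialExt_eq_sum (f : S d → ℝ) (ω : S d) (v : E d) :
    fderiv ℝ (radialExt f) (ω : E d) v = ∑ i, v i * pd i f ω := by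
  conv_lhs => rw [← sum_smul_single v]
  simp [map_sum, pd]

/-- The tangential gradient is orthogonal to the position. -/
theorem sum_coord_mul_pd {f : S d → ℝ} {ω : S d} (hf : DiffAt f ω) :
    ∑ i, coord i ω * pd i f ω = 0 := by
  have h1 : ∑ i, coord i ω * pd i f ω = fderiv ℝ (radialExt f) (ω : E d) (ω : E d) :=
    (fderiv_radialExt_eq_sum f ω ω).symm
  have h2 : HasDerivAt (fun t : ℝ => t • (ω : E d)) (ω : E d) 1 := by
    simpa using (hasDerivAt_id (1 : ℝ)).smul_const (ω : E d)
  have hf' : HasFDerivAt (radialExt f) (fderiv ℝ (radialExt f) (ω : E d)) ((1 : ℝ) • (ω : E d)) := by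
    rw [one_smul]; exact DifferentiableAt.hasFDerivAt hf
  have h3 := hf'.comp_hasDerivAt (1 : ℝ) h2
  have h4 : radialExt f ∘ (fun t : ℝ => t • (ω : E d)) =ᶠ[nhds 1] fun _ => f ω := by
    filter_upwards [lt_mem_nhds (one_pos (α := ℝ))] with t ht
    simp [radialExt_smul f _ ht, radialExt_coe]
  rw [h1]
  exact h3.unique ((hasDerivAt_const (1 : ℝ) (f ω)).congr_of_eventuallyEq h4)

theorem radialExt_apply (A : S d → E d) (i : Fin (d + 1)) (x : E d) :
    radialExt A x i = radialExt (fun ω => A ω i) x := by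
  by_cases hx : x = 0
  · simp [radialExt, hx]
  · simp [radialExt_of_ne _ hx]

/-- The divergence in Cartesian components. -/
theorem sphDiv_eq_sum {A : S d → E d} {ω : S d} (hA : ∀ i, DiffAt (fun η => A η i) ω) :
    sphDiv A ω = ∑ i, pd i (fun η => A η i) ω := by
  have h : HasFDerivAt (radialExt A)
      ((EuclideanSpace.equiv (Fin (d + 1)) ℝ).symm.toContinuousLinearMap.comp
        (ContinuousLinearMap.pi fun i => fderiv ℝ (radialExt fun η => A η i) (ω : E d)))
      (ω : E d) := by
    rw [← hasFDerivWithinAt_univ, hasFDerivWithinAt_euclidean]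
    intro i
    rw [hasFDerivWithinAt_univ]
    have : (fun x => radialExt A x i) = radialExt (fun η => A η i) :=
      funext fun x => radialExt_apply A i x
    rw [this]
    exact DifferentiableAt.hasFDerivAt (hA i)
  rw [sphDiv, h.fderiv,
    LinearMap.trace_eq_sum_inner _ (EuclideanSpace.basisFun (Fin (d + 1)) ℝ)]
  refine Finset.sum_congr rfl fun i _ => ?_
  rw [real_inner_comm, EuclideanSpace.basisFun_apply, inner_single_one]
  rfl

theorem sphLaplacian_eq_sum {f : S d → ℝ} (hf : IsC 2 f) (ω : S d) :
    sphLaplacian f ω = ∑ i, pd i (pd i f) ω := by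
  have h : ∀ i, (fun η => sphGrad f η i) = pd i f := fun i => funext fun η => sphGrad_apply f η i
  rw [sphLaplacian, sphDiv_eq_sum]
  · simp_rw [h]
  · intro i
    rw [h]
    exact (isC_pd hf (l := 1) (by norm_num) i).diffAt le_rfl ω

/-! ### Functions with vanishing gradient -/

theorem abs_fderiv_le (f : S d → ℝ) (ω : S d) (v : E d) :
    |fderiv ℝ (radialExt f) (ω : E d) v| ≤ ‖v‖ * ∑ i, |pd i f ω| := by
  rw [fderiv_radialExt_eq_sum, Finset.mul_sum]
  refine (Finset.abs_sum_le_sum_abs _ _).trans (Finset.sum_le_sum fun i _ => ?_)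
  rw [abs_mul]
  gcongr
  exact PiLp.norm_apply_le v i

/-- Mean value inequality on the ambient ball of radius `1 / 2` about `ω`, which is convex and
avoids the origin. There `‖x‖ ≥ 1 / 2`, and homogeneity of degree `-1` costs the factor `2`. -/
theorem abs_sub_le_of_pd_le {f : S d → ℝ} (hf : ∀ ω, DiffAt f ω) {c : ℝ}
    (hc : ∀ ω, ∑ i, |pd i f ω| ≤ c) {ω η : S d} (h : dist ω η < 1 / 2) :
    |f η - f ω| ≤ 2 * c := by
  have h0 : 0 ≤ c := (Finset.sum_nonneg fun i _ => abs_nonneg _).trans (hc ω)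
  have hball : ∀ x ∈ ball (ω : E d) (1 / 2), x ≠ 0 ∧ 1 / 2 ≤ ‖x‖ := by
    intro x hx
    have h1 : ‖(ω : E d) - x‖ < 1 / 2 := by rwa [mem_ball, dist_comm, dist_eq_norm] at hx
    have h2 : ‖(ω : E d)‖ - ‖x‖ ≤ ‖(ω : E d) - x‖ := norm_sub_norm_le _ _
    rw [norm_coe_S] at h2
    have h3 : 1 / 2 ≤ ‖x‖ := by linarith
    exact ⟨norm_pos_iff.mp (by linarith), h3⟩
  have hd : ∀ x ∈ ball (ω : E d) (1 / 2), DifferentiableAt ℝ (radialExt f) x := by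
    intro x hx
    have hx0 := (hball x hx).1
    have h1 : DifferentiableAt ℝ (radialExt f) (‖x‖⁻¹ • x) := hf (toS x hx0)
    have h2 : DifferentiableAt ℝ (fun y => radialExt f (‖x‖⁻¹ • y)) x :=
      DifferentiableAt.comp x h1 (by fun_prop)
    have h3 : (fun y => radialExt f (‖x‖⁻¹ • y)) = radialExt f :=
      funext fun y => radialExt_smul f y (by positivity)
    rwa [h3] at h2
  have hb : ∀ x ∈ ball (ω : E d) (1 / 2), ‖fderiv ℝ (radialExt f) x‖ ≤ 2 * c := by
    intro x hx
    obtain ⟨hx0, hx1⟩ := hball x hx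
    refine ContinuousLinearMap.opNorm_le_bound _ (by positivity) fun v => ?_
    rw [fderiv_radialExt_of_ne f hx0, _root_.smul_apply, norm_smul, norm_inv, norm_norm]
    have h1 := (abs_fderiv_le f (toS x hx0) v).trans
      (mul_le_mul_of_nonneg_left (hc _) (norm_nonneg v))
    have h2 : ‖x‖⁻¹ ≤ 2 := by
      rw [inv_le_comm₀ (by linarith) two_pos]; linarith
    calc _ ≤ 2 * (‖v‖ * c) := by
          refine mul_le_mul h2 h1 (norm_nonneg _) two_pos.le
      _ = _ := by ring
  have hη : (η : E d) ∈ ball (ω : E d) (1 / 2) := by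
    rw [mem_ball, dist_comm]; exact h
  have hω : (ω : E d) ∈ ball (ω : E d) (1 / 2) := mem_ball_self (by norm_num)
  have := (convex_ball (ω : E d) (1 / 2)).norm_image_sub_le_of_norm_fderiv_le hd hb hω hη
  rw [radialExt_coe, radialExt_coe] at this
  have h5 : ‖(η : E d) - ω‖ ≤ 1 := by
    rw [← dist_eq_norm]; exact (le_of_lt hη).trans (by norm_num)
  exact this.trans (mul_le_of_le_one_right (by positivity) h5)

theorem preconnectedSpace_S (hd : 1 ≤ d) : PreconnectedSpace (S d) := by
  refine Subtype.preconnectedSpace (isPreconnected_sphere ?_ 0 1)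
  rw [← Module.finrank_eq_rank, finrank_euclideanSpace_fin]
  exact_mod_cast (by omega : 1 < d + 1)

/-- The pointwise limit of functions whose gradients tend to zero uniformly is constant. -/
theorem exists_const_of_tendsto (hd : 1 ≤ d) {u : ℕ → S d → ℝ} {f : S d → ℝ}
    (hu : ∀ n ω, DiffAt (u n) ω)
    (hc : ∀ ε > 0, ∀ᶠ n in Filter.atTop, ∀ ω, ∑ i, |pd i (u n) ω| ≤ ε)
    (hf : ∀ ω, Filter.Tendsto (fun n => u n ω) Filter.atTop (nhds (f ω))) (ω η : S d) :
    f ω = f η := by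
  have := preconnectedSpace_S hd
  have hl : IsLocallyConstant f := by
    rw [IsLocallyConstant.iff_eventually_eq]
    intro ω
    filter_upwards [ball_mem_nhds ω (by norm_num : (0 : ℝ) < 1 / 2)] with η hη
    have h1 : Filter.Tendsto (fun n => |u n η - u n ω|) Filter.atTop (nhds |f η - f ω|) :=
      ((hf η).sub (hf ω)).abs
    have h2 : |f η - f ω| ≤ 0 := by
      refine le_of_forall_pos_le_add fun ε hε => ?_
      rw [zero_add]
      refine le_of_tendsto h1 ?_
      filter_upwards [hc (ε / 2) (half_pos hε)] with n hn
      have := abs_sub_le_of_pd_le (hu n) hn (ω := ω) (η := η) (by rwa [mem_ball, dist_comm] at hη)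
      linarith
    exact sub_eq_zero.mp (abs_nonpos_iff.mp h2)
  exact hl.apply_eq_of_preconnectedSpace ω η

theorem exists_const_of_pd_eq_zero (hd : 1 ≤ d) {f : S d → ℝ} (hf : ∀ ω, DiffAt f ω)
    (h : ∀ i ω, pd i f ω = 0) (ω η : S d) : f ω = f η :=
  exists_const_of_tendsto hd (u := fun _ => f) (fun _ => hf)
    (fun ε hε => .of_forall fun _ ω => by simpa [h] using hε.le)
    (fun _ => tendsto_const_nhds) ω η

/-! ### Integration by parts on the sphere -/

theorem continuous_norm_mul {a : ℝ → ℝ} (ha : Continuous a) (h1 : ∀ r < 1, a r = 0)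
    {G : E d → ℝ} (hG : ContinuousOn G {0}ᶜ) : Continuous (fun x => a ‖x‖ * G x) := by
  rw [continuous_iff_continuousAt]
  intro x
  by_cases hx : x = 0
  · subst hx
    have h : (fun x : E d => a ‖x‖ * G x) =ᶠ[nhds 0] fun _ => 0 := by
      filter_upwards [ball_mem_nhds (0 : E d) one_pos] with x hx
      rw [h1 _ (by simpa using hx), zero_mul]
    exact continuousAt_const.congr h.symm
  · exact (ha.comp continuous_norm).continuousAt.mul
      (hG.continuousAt (isOpen_compl_singleton.mem_nhds hx))

theorem hasCompactSupport_norm_mul {a : ℝ → ℝ} {R : ℝ} (h2 : ∀ r > R, a r = 0) (G : E d → ℝ) :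
    HasCompactSupport (fun x => a ‖x‖ * G x) := by
  refine HasCompactSupport.intro (isCompact_closedBall (0 : E d) R) fun x hx => ?_
  rw [h2 _ (by simpa using hx), zero_mul]

theorem integrable_norm_mul {a : ℝ → ℝ} (ha : Continuous a) (h1 : ∀ r < 1, a r = 0) {R : ℝ}
    (h2 : ∀ r > R, a r = 0) {G : E d → ℝ} (hG : ContinuousOn G {0}ᶜ) :
    Integrable (fun x => a ‖x‖ * G x) :=
  (continuous_norm_mul ha h1 hG).integrable_of_hasCompactSupport (hasCompactSupport_norm_mul h2 G)

theorem integral_polar (a : ℝ → ℝ) (F : S d → ℝ) :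
    ∫ x : E d, a ‖x‖ * radialExt F x =
      (∫ ω, F ω ∂(volume : Measure (E d)).toSphere) *
        ∫ r : Set.Ioi (0 : ℝ), a r ∂(Measure.volumeIoiPow d) := by
  have hfin : Module.finrank ℝ (E d) - 1 = d := by simp
  calc ∫ x : E d, a ‖x‖ * radialExt F x
      = ∫ x : ({(0 : E d)}ᶜ : Set (E d)), a ‖x.1‖ * radialExt F x.1
          ∂(Measure.comap (↑) (volume : Measure (E d))) := by
        rw [integral_subtype_comap (measurableSet_singleton _).compl
          fun x : E d => a ‖x‖ * radialExt F x, restrict_compl_singleton]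
    _ = ∫ p, F p.1 * a p.2
          ∂((volume : Measure (E d)).toSphere.prod (Measure.volumeIoiPow d)) := by
        have h := (volume : Measure (E d)).measurePreserving_homeomorphUnitSphereProd.integral_comp
          (Homeomorph.measurableEmbedding _)
          (fun p : S d × Set.Ioi (0 : ℝ) => F p.1 * a p.2)
        rw [hfin] at h
        rw [← h]
        refine integral_congr_ae (Filter.Eventually.of_forall fun x => ?_)
        have hx : (x : E d) ≠ 0 := x.2
        have h3 : ((homeomorphUnitSphereProd (E d)) x).1 = toS (x : E d) hx := by
          ext1; simp [toS]
        simp only [h3, radialExt_of_ne F hx, homeomorphUnitSphereProd_apply_snd_coe]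
        ring
    _ = _ := integral_prod_mul F fun r : Set.Ioi (0 : ℝ) => a r

theorem integral_unif (F : S d → ℝ) :
    ∫ ω, F ω ∂(unif d) =
      (((volume : Measure (E d)).toSphere Set.univ)⁻¹).toReal *
        ∫ ω, F ω ∂(volume : Measure (E d)).toSphere := by
  rw [unif, integral_smul_measure, smul_eq_mul]

theorem continuousOn_radialExt {F : S d → ℝ} (hF : Continuous F) :
    ContinuousOn (radialExt F) {0}ᶜ := by
  rw [continuousOn_iff_continuous_domRestrict]
  have : ({0}ᶜ : Set (E d)).domRestrict (radialExt F) = fun x : ({0}ᶜ : Set (E d)) => F (toS (x : E d) x.2) := by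
    ext x
    exact radialExt_of_ne F x.2
  rw [this]
  refine hF.comp (Continuous.subtype_mk ?_ _)
  exact (Continuous.inv₀ (by fun_prop) fun x => norm_ne_zero_iff.mpr x.2).smul
    continuous_subtype_val

theorem continuous_coord (i : Fin (d + 1)) : Continuous (coord (d := d) i) :=
  (isC_coord 0 i).continuous

theorem continuous_pd {F : S d → ℝ} (hF : IsC 1 F) (i : Fin (d + 1)) : Continuous (pd i F) :=
  (isC_pd hF (l := 0) (by norm_num) i).continuous

theorem integrable_unif {F : S d → ℝ} (hF : Continuous F) (μ : Measure (S d))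
    [IsFiniteMeasure μ] : Integrable F μ :=
  hF.integrable_of_hasCompactSupport (HasCompactSupport.of_compactSpace _)

/-- Integrate by parts in the ambient space the product of a radial cutoff `ψ(‖x‖)` and the radial
extension of `F`, then pass to polar coordinates. The radial integrals factor out as constants that
do not depend on `F` or `i`. -/
theorem exists_integral_pd_relation : ∃ α β : ℝ, 0 < β ∧ ∀ (F : S d → ℝ), IsC 1 F → ∀ i,
    α * (∫ ω, coord i ω * F ω ∂(unif d)) + β * ∫ ω, pd i F ω ∂(unif d) = 0 := by
  -- The cutoff is supported in `1 ≤ r ≤ 3`, away from the origin where radial extensions are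
  -- singular.
  let ψ : ContDiffBump (2 : ℝ) := ⟨1 / 2, 1, by norm_num, by norm_num⟩
  have hψ : ContDiff ℝ 1 ψ := ψ.contDiff
  have hψ1 : ∀ r < 1, ψ r = 0 := fun r hr => by
    refine ψ.zero_of_le_dist ?_
    rw [Real.dist_eq, abs_sub_comm]
    exact le_trans (by simp only [ψ]; linarith) (le_abs_self _)
  have hψ3 : ∀ r > 3, ψ r = 0 := fun r hr => by
    refine ψ.zero_of_le_dist ?_
    rw [Real.dist_eq]
    exact le_trans (by simp only [ψ]; linarith) (le_abs_self _)
  have hdc : Continuous (deriv ψ) := hψ.continuous_deriv le_rfl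
  have hd1 : ∀ r < 1, deriv ψ r = 0 := fun r hr => by
    have : ψ =ᶠ[nhds r] fun _ => 0 := by
      filter_upwards [Iio_mem_nhds hr] with s hs using hψ1 s hs
    simp [this.deriv_eq]
  have hd3 : ∀ r > 3, deriv ψ r = 0 := fun r hr => by
    have : ψ =ᶠ[nhds r] fun _ => 0 := by
      filter_upwards [Ioi_mem_nhds hr] with s hs using hψ3 s hs
    simp [this.deriv_eq]
  have hΦ : ∀ x : E d, x ≠ 0 → HasFDerivAt (fun x : E d => ψ ‖x‖)
      (deriv ψ ‖x‖ • fderiv ℝ (fun x : E d => ‖x‖) x) x := fun x hx =>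
    ((hψ.differentiable one_ne_zero).differentiableAt.hasDerivAt).comp_hasFDerivAt x
      ((contDiffAt_norm ℝ hx (n := 1)).differentiableAt one_ne_zero).hasFDerivAt
  have hn : ∀ x : E d, x ≠ 0 → ∀ i, fderiv ℝ (fun x : E d => ‖x‖) x (EuclideanSpace.single i 1)
      = radialExt (coord i) x := fun x hx i => by
    have h1 := (hasStrictFDerivAt_norm_sq x).hasFDerivAt.sqrt
      (pow_ne_zero 2 (norm_ne_zero_iff.mpr hx))
    simp only [norm_nonneg, Real.sqrt_sq] at h1
    rw [h1.fderiv, radialExt_of_ne _ hx]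
    simp only [_root_.smul_apply, innerSL_apply_apply, inner_single_one, coord, toS, PiLp.smul_apply,
      smul_eq_mul, nsmul_eq_mul]
    have := norm_ne_zero_iff.mpr hx
    field_simp
    norm_num
  have hΦ' : ∀ (x : E d) i, fderiv ℝ (fun x : E d => ψ ‖x‖) x (EuclideanSpace.single i 1) =
      deriv ψ ‖x‖ * radialExt (coord i) x := fun x i => by
    by_cases hx : x = 0
    · subst hx
      have : (fun x : E d => ψ ‖x‖) =ᶠ[nhds 0] fun _ => 0 := by
        filter_upwards [ball_mem_nhds (0 : E d) one_pos] with x hx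
        exact hψ1 _ (by simpa using hx)
      simp [this.fderiv_eq, hd1]
    · rw [(hΦ x hx).fderiv, _root_.smul_apply, hn x hx, smul_eq_mul]
  have hsub : tsupport (fun x : E d => ψ ‖x‖) ⊆ {0}ᶜ := by
    have : tsupport (fun x : E d => ψ ‖x‖) ⊆ (ball 0 1)ᶜ := by
      refine closure_minimal (fun x hx => ?_) isOpen_ball.isClosed_compl
      by_contra h
      exact hx (hψ1 _ (by simpa using h))
    exact this.trans (Set.compl_subset_compl.mpr (by simp))
  set β₀ := ∫ r : Set.Ioi (0 : ℝ), ψ r * (r : ℝ)⁻¹ ∂(Measure.volumeIoiPow d) with hβ₀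
  set α₀ := ∫ r : Set.Ioi (0 : ℝ), deriv ψ r ∂(Measure.volumeIoiPow d) with hα₀
  refine ⟨α₀, β₀, ?_, ?_⟩
  · have h1 := integral_polar (fun r => ψ r * r⁻¹) (fun _ : S d => (1 : ℝ))
    rw [← hβ₀] at h1
    have hcont : Continuous (fun x : E d => ψ ‖x‖ * (‖x‖⁻¹ * radialExt (fun _ => (1 : ℝ)) x)) :=
      continuous_norm_mul hψ.continuous hψ1
        ((continuous_norm.continuousOn.inv₀ fun x hx => norm_ne_zero_iff.mpr hx).mul
          (continuousOn_radialExt continuous_const))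
    have hpos : 0 < ∫ x : E d, ψ ‖x‖ * (‖x‖⁻¹ * radialExt (fun _ => (1 : ℝ)) x) := by
      have hne : ∃ x : E d, ‖x‖ = 2 := ⟨(2 : ℝ) • EuclideanSpace.single 0 1, by simp [norm_smul]⟩
      obtain ⟨x₀, hx₀⟩ := hne
      have hx0 : x₀ ≠ 0 := by rintro rfl; simp at hx₀
      refine hcont.integral_pos_of_hasCompactSupport_nonneg_nonzero (x := x₀)
        (hasCompactSupport_norm_mul hψ3 _) (fun x => ?_) ?_
      · refine mul_nonneg ψ.nonneg (mul_nonneg (by positivity) ?_)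
        by_cases hx : x = 0
        · simp [radialExt, hx]
        · simp [radialExt_of_ne _ hx]
      · rw [radialExt_of_ne _ hx0, hx₀]
        have : ψ 2 = 1 := ψ.one_of_mem_closedBall (mem_closedBall_self ψ.rIn_pos.le)
        rw [this]; norm_num
    simp_rw [← mul_assoc] at hpos
    rw [h1] at hpos
    exact pos_of_mul_pos_right hpos (integral_nonneg fun _ => zero_le_one)
  · intro F hF i
    have hG : ContinuousOn (fun x : E d => fderiv ℝ (radialExt F) x (EuclideanSpace.single i 1))
        {0}ᶜ :=
      ((isC_iff.mp hF).continuousOn_fderiv_of_isOpen isOpen_compl_singleton (by simp)).clm_apply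
        continuousOn_const
    have hF0 := continuousOn_radialExt hF.continuous
    have hc0 := continuousOn_radialExt (continuous_coord (d := d) i)
    have h := integral_mul_fderiv_eq_neg_fderiv_mul_of_integrable (𝕜 := ℝ) (μ := volume)
      (f := fun x : E d => ψ ‖x‖) (g := radialExt F) (v := EuclideanSpace.single i 1)
      (by simp only [hΦ', mul_assoc]
          exact integrable_norm_mul hdc hd1 hd3 (hc0.mul hF0))
      (integrable_norm_mul hψ.continuous hψ1 hψ3 hG)
      (integrable_norm_mul hψ.continuous hψ1 hψ3 hF0)
      (fun x _ => by
        by_cases hx : x = 0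
        · subst hx
          have : (fun x : E d => ψ ‖x‖) =ᶠ[nhds 0] fun _ => 0 := by
            filter_upwards [ball_mem_nhds (0 : E d) one_pos] with x hx
            exact hψ1 _ (by simpa using hx)
          exact (differentiableAt_const (0 : ℝ)).congr_of_eventuallyEq this
        · exact (hΦ x hx).differentiableAt)
      (fun x hx => (hF.contDiffAt (hsub hx)).differentiableAt one_ne_zero)
    have h1 : ∀ x : E d, ψ ‖x‖ * fderiv ℝ (radialExt F) x (EuclideanSpace.single i 1) =
        (fun r => ψ r * r⁻¹) ‖x‖ * radialExt (pd i F) x := fun x => by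
      by_cases hx : x = 0
      · have : ψ ‖x‖ = 0 := hψ1 _ (by simp [hx])
        simp [this]
      · rw [fderiv_radialExt_apply F hx]; ring
    have h2 : ∀ x : E d, fderiv ℝ (fun x : E d => ψ ‖x‖) x (EuclideanSpace.single i 1) *
        radialExt F x = deriv ψ ‖x‖ * radialExt (fun ω => coord i ω * F ω) x := fun x => by
      rw [hΦ']
      by_cases hx : x = 0
      · simp [radialExt, hx]
      · simp only [radialExt_of_ne _ hx]; ring
    rw [integral_congr_ae (.of_forall h1), integral_congr_ae (.of_forall h2)] at h
    rw [integral_polar (deriv ψ), integral_polar (fun r => ψ r * r⁻¹)] at h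
    rw [integral_unif, integral_unif]
    linear_combination (((volume : Measure (E d)).toSphere Set.univ)⁻¹).toReal * h

/-- Integration by parts on the sphere. -/
theorem integral_pd {F : S d → ℝ} (hF : IsC 1 F) (i : Fin (d + 1)) :
    ∫ ω, pd i F ω ∂(unif d) = d * ∫ ω, coord i ω * F ω ∂(unif d) := by
  obtain ⟨α, β, hβ, h⟩ := exists_integral_pd_relation (d := d)
  have hint : ∀ j : Fin (d + 1), Integrable (fun ω => coord j ω * coord j ω) (unif d) := fun j =>
    integrable_unif ((continuous_coord j).mul (continuous_coord j)) _
  have hsum : ∑ j : Fin (d + 1), ∫ ω, coord j ω * coord j ω ∂(unif d) = 1 := by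
    rw [← integral_finsetSum _ fun j _ => hint j]
    simp [sum_coord_sq]
  -- The ratio of the constants is found by testing with the coordinates: summing over `F = coord
  -- j`, `i = j` gives `α + d β = 0`, since `∑ coord j ^ 2 = 1`.
  have h1 : ∑ j : Fin (d + 1), (α * (∫ ω, coord j ω * coord j ω ∂(unif d)) +
      β * (1 - ∫ ω, coord j ω * coord j ω ∂(unif d))) = 0 := by
    refine Finset.sum_eq_zero fun j _ => ?_
    rw [← h _ (isC_coord 1 j) j]
    congr 2
    simp only [pd_coord, if_true]
    rw [integral_sub (integrable_const _) (hint j)]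
    simp
  rw [Finset.sum_add_distrib, ← Finset.mul_sum, ← Finset.mul_sum, Finset.sum_sub_distrib, hsum]
    at h1
  simp at h1
  have h2 := h F hF i
  have h3 : β * ((∫ ω, pd i F ω ∂(unif d)) - d * ∫ ω, coord i ω * F ω ∂(unif d)) = 0 := by
    linear_combination h2 - (∫ ω, coord i ω * F ω ∂(unif d)) * h1
  exact sub_eq_zero.mp ((mul_eq_zero.mp h3).resolve_left hβ.ne')

/-- Nonempty open sets have positive measure, so almost everywhere identities between continuous
functions hold everywhere. -/
instance (d : ℕ) : (unif d).IsOpenPosMeasure := by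
  unfold unif
  refine Measure.isOpenPosMeasure_smul _ ?_
  exact ENNReal.inv_ne_zero.mpr (measure_ne_top _ _)

/-! ### Green's formulas -/

theorem integral_mul_pd {f g : S d → ℝ} (hf : IsC 1 f) (hg : IsC 1 g) (i : Fin (d + 1)) :
    ∫ ω, g ω * pd i f ω ∂(unif d) =
      -(∫ ω, f ω * pd i g ω ∂(unif d)) + d * ∫ ω, coord i ω * (f ω * g ω) ∂(unif d) := by
  have h := integral_pd (hf.mul hg) i
  have h1 : ∀ ω, pd i (fun η => f η * g η) ω = f ω * pd i g ω + g ω * pd i f ω := fun ω =>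
    pd_mul (hf.diffAt le_rfl ω) (hg.diffAt le_rfl ω) i
  simp_rw [h1] at h
  rw [integral_add (integrable_unif (hf.continuous.fun_mul (continuous_pd hg i)) _)
    (integrable_unif (hg.continuous.fun_mul (continuous_pd hf i)) _)] at h
  linarith

theorem integral_sum_unif {F : Fin (d + 1) → S d → ℝ} (hF : ∀ i, Continuous (F i)) :
    ∫ ω, ∑ i, F i ω ∂(unif d) = ∑ i, ∫ ω, F i ω ∂(unif d) :=
  integral_finsetSum _ fun i _ => integrable_unif (hF i) _

/-- The divergence theorem for tangent fields, tested against a function. -/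
theorem integral_mul_sum_pd {B : Fin (d + 1) → S d → ℝ} (hB : ∀ i, IsC 1 (B i))
    (hBt : ∀ ω, ∑ i, coord i ω * B i ω = 0) {g : S d → ℝ} (hg : IsC 1 g) :
    ∫ ω, g ω * ∑ i, pd i (B i) ω ∂(unif d) = -∫ ω, ∑ i, B i ω * pd i g ω ∂(unif d) := by
  have h1 : ∑ i, ∫ ω, coord i ω * (B i ω * g ω) ∂(unif d) = 0 := by
    rw [← integral_sum_unif fun i =>
      (continuous_coord i).fun_mul ((hB i).continuous.fun_mul hg.continuous)]
    have : ∀ ω : S d, ∑ i, coord i ω * (B i ω * g ω) = 0 := fun ω => by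
      rw [← zero_mul (g ω), ← hBt ω, Finset.sum_mul]
      exact Finset.sum_congr rfl fun i _ => by ring
    simp [this]
  simp_rw [Finset.mul_sum]
  rw [integral_sum_unif fun i => hg.continuous.fun_mul (continuous_pd (hB i) i),
    integral_sum_unif fun i => (hB i).continuous.fun_mul (continuous_pd hg i)]
  simp_rw [integral_mul_pd (hB _) hg]
  rw [Finset.sum_add_distrib, ← Finset.mul_sum, h1, Finset.sum_neg_distrib, mul_zero, add_zero]

theorem integral_mul_sum_pd_pd {f g : S d → ℝ} (hf : IsC 2 f) (hg : IsC 1 g) :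
    ∫ ω, g ω * ∑ i, pd i (pd i f) ω ∂(unif d) = -∫ ω, ∑ i, pd i f ω * pd i g ω ∂(unif d) :=
  integral_mul_sum_pd (fun i => isC_pd hf (l := 1) (by norm_num) i)
    (fun ω => sum_coord_mul_pd (hf.diffAt (by norm_num) ω)) hg

/-! ### Densities -/

theorem IsDensity.integral_eq {f : S d → ℝ} {ν : Measure (S d)} (h : IsDensity f ν)
    (g : S d → ℝ) : ∫ ω, g ω ∂ν = ∫ ω, f ω * g ω ∂(unif d) := by
  rw [h.2.2, integral_withDensity_eq_integral_toReal_smul h.1.ennreal_ofReal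
    (Filter.Eventually.of_forall fun _ => ENNReal.ofReal_lt_top)]
  simp [ENNReal.toReal_ofReal (h.2.1 _)]

theorem IsDensity.JMeas_eq {f : S d → ℝ} {ν : Measure (S d)} (h : IsDensity f ν) :
    JMeas ν = J f := by
  rw [JMeas, J, h.2.2, integral_withDensity_eq_integral_toReal_smul h.1.ennreal_ofReal
    (Filter.Eventually.of_forall fun _ => ENNReal.ofReal_lt_top)]
  rw [h.2.2] at h
  simp [ENNReal.toReal_ofReal (h.2.1 _)]

theorem IsDensity.integral_eq_one {f : S d → ℝ} {ν : Measure (S d)} [IsProbabilityMeasure ν]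
    (h : IsDensity f ν) : ∫ ω, f ω ∂(unif d) = 1 := by
  have := h.integral_eq fun _ => 1
  simpa using this.symm

/-! ### Stationary densities of the form `exp ((C + ω · J) / σ)` -/

theorem tangProj_apply (ω : S d) (V : E d) (i : Fin (d + 1)) :
    tangProj ω V i = V i - ⟪(ω : E d), V⟫_ℝ * coord i ω := by
  simp [tangProj, coord]

theorem sum_coord_mul_tangProj (ω : S d) (V : E d) : ∑ i, coord i ω * tangProj ω V i = 0 := by
  have h : ∑ i, coord i ω * V i = ⟪(ω : E d), V⟫_ℝ := by
    simp [PiLp.inner_apply, coord, mul_comm]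
  calc ∑ i, coord i ω * tangProj ω V i
      = ∑ i, coord i ω * V i - ⟪(ω : E d), V⟫_ℝ * ∑ i, coord i ω * coord i ω := by
        rw [Finset.mul_sum, ← Finset.sum_sub_distrib]
        exact Finset.sum_congr rfl fun i _ => by rw [tangProj_apply]; ring
    _ = 0 := by rw [h, sum_coord_sq]; ring

theorem isC_tangProj (k : ℕ∞) (V : E d) (i : Fin (d + 1)) :
    IsC k (fun ω : S d => tangProj ω V i) := by
  simp_rw [tangProj_apply]
  exact (isC_const k _).sub ((isC_inner k V).mul (isC_coord k i))

theorem isC_exp_inner (k : ℕ∞) (v : E d) (C σ : ℝ) :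
    IsC k (fun ω : S d => Real.exp ((C + ⟪(ω : E d), v⟫_ℝ) / σ)) :=
  isC_comp (isC_inner k v) (φ := fun t => Real.exp ((C + t) / σ)) fun _ => by fun_prop

theorem pd_exp_inner (v : E d) (C σ : ℝ) (i : Fin (d + 1)) (ω : S d) :
    pd i (fun ω : S d => Real.exp ((C + ⟪(ω : E d), v⟫_ℝ) / σ)) ω =
      σ⁻¹ * (Real.exp ((C + ⟪(ω : E d), v⟫_ℝ) / σ) * tangProj ω v i) := by
  have h1 := ((hasDerivAt_id' (⟪(ω : E d), v⟫_ℝ)).const_add C |>.div_const σ).exp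
  rw [(pd_comp ((isC_inner 1 v).diffAt le_rfl ω) h1 i).2, pd_inner, tangProj_apply]
  ring

theorem eq_exp_of_chemPot_eq {σ : ℝ} (hσ : 0 < σ) {f : S d → ℝ} (hf : ∀ ω, 0 < f ω) {C : ℝ}
    (h : ∀ ω, chemPot σ f ω = C) :
    f = fun ω : S d => Real.exp ((C + ⟪(ω : E d), J f⟫_ℝ) / σ) := by
  ext ω
  have h1 : Real.log (f ω) = (C + ⟪(ω : E d), J f⟫_ℝ) / σ := by
    rw [← h ω, chemPot]; field_simp; ring
  rw [← h1, Real.exp_log (hf ω)]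

theorem Q_eq_sum {σ : ℝ} {f : S d → ℝ} (hf : IsC 2 f) (ω : S d) :
    Q σ f ω = -∑ i, pd i (fun η => f η * tangProj η (J f) i) ω +
      σ * ∑ i, pd i (pd i f) ω := by
  rw [Q, sphLaplacian_eq_sum hf, sphDiv_eq_sum]
  · rfl
  · intro i
    exact ((hf.of_le (by norm_num)).mul (isC_tangProj 1 (J f) i)).diffAt le_rfl ω

/-- The explicit exponential form supplies the regularity. Its gradient is `σ⁻¹ f (Id - ω ⊗ ω)
J[f]`, so drift and diffusion fluxes cancel before any divergence is taken. -/
theorem Q_eq_zero_of_chemPot_eq {σ : ℝ} (hσ : 0 < σ) {f : S d → ℝ} (hf : ∀ ω, 0 < f ω) {C : ℝ}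
    (h : ∀ ω, chemPot σ f ω = C) : IsC 2 f ∧ ∀ ω, Q σ f ω = 0 := by
  have he := eq_exp_of_chemPot_eq hσ hf h
  have hC : IsC 2 f := by rw [he]; exact isC_exp_inner 2 _ _ _
  refine ⟨hC, fun ω => ?_⟩
  have h1 : ∀ i, pd i f = fun ω => σ⁻¹ * (f ω * tangProj ω (J f) i) := fun i => by
    ext ω
    have h2 := pd_exp_inner (J f) C σ i ω
    rw [← he] at h2
    rw [h2, ← congrFun he ω]
  have h3 : ∀ i, pd i (pd i f) ω = σ⁻¹ * pd i (fun η => f η * tangProj η (J f) i) ω := fun i => by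
    rw [h1]
    exact pd_const_mul
      (((hC.of_le (by norm_num)).mul (isC_tangProj 1 (J f) i)).diffAt le_rfl ω) _ i
  rw [Q_eq_sum hC]
  simp_rw [h3]
  rw [← Finset.mul_sum, mul_inv_cancel_left₀ hσ.ne']
  ring

theorem dissipation_eq_zero_of_chemPot_eq {σ : ℝ} {f : S d → ℝ} {C : ℝ}
    (h : ∀ ω, chemPot σ f ω = C) : dissipation σ f = 0 := by
  have h1 : chemPot σ f = fun _ => C := funext h
  have h2 : ∀ ω, ‖sphGrad (chemPot σ f) ω‖ ^ 2 = 0 := fun ω => by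
    rw [norm_sq_sphGrad, h1]
    simp [pd_const]
  simp [dissipation, h2]

/-! ### Classical stationary solutions are weak ones -/

theorem weakRhs_eq_zero_of_Q_eq_zero {σ : ℝ} {f : S d → ℝ} {ν : Measure (S d)}
    (hfν : IsDensity f ν) (hf : IsC 2 f) (hQ : ∀ ω, Q σ f ω = 0) {h : S d → ℝ} (hh : IsC ⊤ h) :
    weakRhs σ ν h = 0 := by
  have hf1 : IsC 1 f := hf.of_le (by norm_num)
  have hh1 : IsC 1 h := hh.of_le le_top
  have hh2 : IsC 2 h := hh.of_le le_top
  have hB : ∀ i, IsC 1 (fun ω : S d => f ω * tangProj ω (J f) i) := fun i =>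
    hf1.mul (isC_tangProj 1 (J f) i)
  have hdiv := integral_mul_sum_pd hB (fun ω => by
    rw [← mul_zero (f ω), ← sum_coord_mul_tangProj ω (J f), Finset.mul_sum]
    exact Finset.sum_congr rfl fun i _ => by ring) hh1
  -- The weak formulation contains `J` itself and `Q` its tangential projection; they agree here
  -- because `∇h` is tangent.
  have hgrad : ∀ ω, f ω * ⟪J f, sphGrad h ω⟫_ℝ =
      ∑ i, f ω * tangProj ω (J f) i * pd i h ω := fun ω => by
    rw [inner_sphGrad, Finset.mul_sum]
    have h0 := sum_coord_mul_pd (hh1.diffAt le_rfl ω)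
    have : ∀ i, f ω * tangProj ω (J f) i * pd i h ω = f ω * (J f i * pd i h ω) -
        f ω * ⟪(ω : E d), J f⟫_ℝ * (coord i ω * pd i h ω) := fun i => by
      rw [tangProj_apply]; ring
    simp_rw [this]
    rw [Finset.sum_sub_distrib, ← Finset.mul_sum (a := f ω * _), h0]
    simp
  have hL1 := integral_mul_sum_pd_pd hh2 hf1
  have hL2 := integral_mul_sum_pd_pd hf hh1
  have hQ' : ∫ ω, h ω * Q σ f ω ∂(unif d) = 0 := by simp [hQ]
  have hQ2 : ∀ ω, h ω * Q σ f ω =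
      -(h ω * ∑ i, pd i (fun η => f η * tangProj η (J f) i) ω) +
      σ * (h ω * ∑ i, pd i (pd i f) ω) := fun ω => by rw [Q_eq_sum hf]; ring
  simp_rw [hQ2] at hQ'
  have hc1 : Continuous fun ω => h ω * ∑ i, pd i (fun η => f η * tangProj η (J f) i) ω :=
    hh.continuous.mul (continuous_finsetSum _ fun i _ => continuous_pd (hB i) i)
  have hc2 : Continuous fun ω => h ω * ∑ i, pd i (pd i f) ω :=
    hh.continuous.mul (continuous_finsetSum _ fun i _ =>
      continuous_pd (isC_pd hf (l := 1) (by norm_num) i) i)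
  rw [integral_add (integrable_unif hc1 _).fun_neg ((integrable_unif hc2 _).const_mul σ),
    integral_neg, integral_const_mul, hdiv, hL2] at hQ'
  rw [weakRhs, hfν.integral_eq, hfν.integral_eq, hfν.JMeas_eq]
  simp_rw [sphLaplacian_eq_sum hh2, hgrad]
  rw [hL1]
  simp_rw [mul_comm (pd _ h _) (pd _ f _)]
  linarith

theorem isSteadyState_iff {σ : ℝ} {ν : Measure (S d)} [IsProbabilityMeasure ν] :
    IsSteadyState σ ν ↔ ∀ h : S d → ℝ, IsC ⊤ h → weakRhs σ ν h = 0 := by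
  constructor
  · intro hs h hh
    have h1 := (hs.2 h hh 1 zero_le_one).2
    simpa using h1.symm
  · intro hs
    refine ⟨inferInstance, fun h hh t ht => ?_⟩
    simp [hs h hh]

/-! ### Vanishing dissipation -/

/-- A zero of a nonnegative function is a minimum. This controls the gradient exactly where the
dissipation gives no information. -/
theorem pd_eq_zero_of_nonneg {f : S d → ℝ} (hf : ∀ ω, 0 ≤ f ω) {ω : S d} (h0 : f ω = 0)
    (i : Fin (d + 1)) : pd i f ω = 0 := by
  have h : IsLocalMin (radialExt f) (ω : E d) := by
    refine Filter.Eventually.of_forall fun x => ?_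
    rw [radialExt_coe, h0]
    by_cases hx : x = 0
    · simp [radialExt, hx]
    · rw [radialExt_of_ne _ hx]; exact hf _
  simp [pd, h.fderiv_eq_zero]

/-- Where `f > 0`, `f ∇(σ ln f - ω · J)` is a positive multiple of `∇g` with `g = f exp (-ω · J /
σ)`, and `g` is `C¹` even across the zeros of `f`. Hence `∇g = 0` everywhere and `g` is constant;
the constant is not zero because `f` has mass one, so `f` has no zeros after all. -/
theorem exists_chemPot_eq_of_dissipation_eq_zero (hd : 1 ≤ d) {σ : ℝ} (hσ : 0 < σ) {f : S d → ℝ}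
    (hf : IsC 1 f) (hf0 : ∀ ω, 0 ≤ f ω) (hf1 : ∫ ω, f ω ∂(unif d) = 1)
    (h : dissipation σ f = 0) : (∀ ω, 0 < f ω) ∧ ∃ C : ℝ, ∀ ω, chemPot σ f ω = C := by
  set v := J f with hv
  let W : S d → ℝ := fun ω => Real.exp ((0 + ⟪(ω : E d), v⟫_ℝ) / (-σ))
  have hW : IsC 1 W := isC_exp_inner 1 v 0 (-σ)
  let g : S d → ℝ := fun ω => f ω * W ω
  have hg : IsC 1 g := hf.mul hW
  have hgpd : ∀ i ω, pd i g ω = W ω * (pd i f ω - σ⁻¹ * f ω * tangProj ω v i) := fun i ω => by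
    rw [pd_mul (hf.diffAt le_rfl ω) (hW.diffAt le_rfl ω), pd_exp_inner, inv_neg]
    simp only [W]; ring
  have hchem : ∀ i ω, 0 < f ω →
      f ω * pd i (chemPot σ f) ω = σ * (pd i f ω - σ⁻¹ * f ω * tangProj ω v i) := fun i ω hω => by
    have h1 := pd_comp (hf.diffAt le_rfl ω) (φ := fun t => σ * Real.log t)
      ((Real.hasDerivAt_log hω.ne').const_mul σ) i
    have h2 : pd i (chemPot σ f) ω = σ * (f ω)⁻¹ * pd i f ω - tangProj ω v i := by
      have h3 := pd_sub h1.1 ((isC_inner 1 v).diffAt le_rfl ω) i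
      rw [h1.2, pd_inner, ← tangProj_apply] at h3
      exact h3
    rw [h2]; field_simp
  have hopen : IsOpen {ω | ∃ i, pd i g ω ≠ 0} := by
    simp only [Set.ofPred_exists]
    exact isOpen_iUnion fun i => isOpen_ne_fun (continuous_pd hg i) continuous_const
  -- The dissipation integrand rewritten through `∇g`, which makes it visibly measurable. At zeros
  -- of `f` both expressions are `0`, by the convention `0⁻¹ = 0`.
  let k : S d → ENNReal := fun ω =>
    ENNReal.ofReal ((f ω)⁻¹ * ∑ i, (σ * ((W ω)⁻¹ * pd i g ω)) ^ 2)
  have hkm : Measurable k := by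
    refine ((hf.continuous.measurable.inv).mul
      (Finset.measurable_sum _ fun i _ => ?_)).ennreal_ofReal
    exact (((hW.continuous.measurable.inv).mul
      (continuous_pd hg i).measurable).const_mul σ).pow_const 2
  have hWpos : ∀ ω, 0 < W ω := fun ω => Real.exp_pos _
  have hk : ∀ ω, k ω ≤ ENNReal.ofReal (f ω * ‖sphGrad (chemPot σ f) ω‖ ^ 2) := fun ω => by
    refine ENNReal.ofReal_le_ofReal (le_of_eq ?_)
    rcases (hf0 ω).eq_or_lt with h0 | hω
    · simp [← h0]
    rw [norm_sq_sphGrad, Finset.mul_sum, Finset.mul_sum]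
    refine Finset.sum_congr rfl fun i _ => ?_
    rw [hgpd, inv_mul_cancel_left₀ (hWpos ω).ne', ← hchem i ω hω]
    field_simp
  have hk0 : k =ᵐ[unif d] 0 := (lintegral_eq_zero_iff hkm).mp
    (le_antisymm ((lintegral_mono hk).trans h.le) bot_le)
  have hempty : {ω | ∃ i, pd i g ω ≠ 0} = ∅ := by
    refine hopen.eq_empty_of_measure_zero (measure_mono_null ?_ hk0)
    rintro ω ⟨i, hi⟩ (hkω : k ω = 0)
    have hfω : 0 < f ω := by
      refine lt_of_le_of_ne (hf0 ω) fun h0 => hi ?_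
      rw [hgpd, pd_eq_zero_of_nonneg hf0 h0.symm, ← h0]; ring
    refine hkω.not_gt (ENNReal.ofReal_pos.mpr ?_)
    refine mul_pos (inv_pos.mpr hfω)
      (Finset.sum_pos' (fun j _ => sq_nonneg _) ⟨i, Finset.mem_univ i, ?_⟩)
    have := (hWpos ω).ne'
    positivity
  have hg0 : ∀ i ω, pd i g ω = 0 := fun i ω => by
    by_contra hne
    exact (Set.eq_empty_iff_forall_notMem.mp hempty ω) ⟨i, hne⟩
  have hconst := exists_const_of_pd_eq_zero hd (fun ω => hg.diffAt le_rfl ω) hg0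
  have hne : ∃ ω, f ω ≠ 0 := by
    by_contra hall
    push Not at hall
    simp [hall] at hf1
  obtain ⟨ω₀, hω₀⟩ := hne
  have hg₀ : 0 < g ω₀ := mul_pos (lt_of_le_of_ne (hf0 ω₀) hω₀.symm) (hWpos ω₀)
  have hfpos : ∀ ω, 0 < f ω := fun ω => by
    have h1 : 0 < f ω * W ω := by
      have := hconst ω ω₀
      simp only [g] at this hg₀
      rw [this]; exact hg₀
    exact pos_of_mul_pos_left h1 (hWpos ω).le
  refine ⟨hfpos, σ * Real.log (g ω₀), fun ω => ?_⟩
  rw [← hconst ω ω₀]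
  simp only [g, W, chemPot]
  rw [Real.log_mul (hfpos ω).ne' (Real.exp_pos _).ne', Real.log_exp]
  field_simp
  ring

/-! ### Critical points of the free energy -/

/-- The remainder equals `t log (t / s) - (t - s)`, and `1 - 1 / x ≤ log x ≤ x - 1` places it
between `0` and `(t - s) ^ 2 / s`. -/
theorem mul_log_remainder {s t : ℝ} (hs : 0 < s) (ht : 0 < t) :
    |t * Real.log t - s * Real.log s - (Real.log s + 1) * (t - s)| ≤ (t - s) ^ 2 / s := by
  have e : t * Real.log t - s * Real.log s - (Real.log s + 1) * (t - s) =
      t * Real.log (t / s) - (t - s) := by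
    rw [Real.log_div ht.ne' hs.ne']; ring
  have h1 : Real.log (t / s) ≤ t / s - 1 := Real.log_le_sub_one_of_pos (div_pos ht hs)
  have h2 : 1 - (t / s)⁻¹ ≤ Real.log (t / s) := Real.one_sub_inv_le_log_of_pos (div_pos ht hs)
  rw [e, abs_of_nonneg]
  · have := mul_le_mul_of_nonneg_left h1 ht.le
    have e2 : t * (t / s - 1) - (t - s) = (t - s) ^ 2 / s := by field_simp
    linarith
  · have := mul_le_mul_of_nonneg_left h2 ht.le
    have e2 : t * (1 - (t / s)⁻¹) = t - s := by field_simp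
    linarith

theorem integrable_smul_coe {f : S d → ℝ} (hf : Continuous f) :
    Integrable (fun ω : S d => f ω • (ω : E d)) (unif d) :=
  (hf.smul continuous_subtype_val).integrable_of_hasCompactSupport
    (HasCompactSupport.of_compactSpace _)

theorem J_add {f g : S d → ℝ} (hf : Continuous f) (hg : Continuous g) :
    J (fun ω => f ω + g ω) = J f + J g := by
  simp only [J, add_smul]
  exact integral_add (integrable_smul_coe hf) (integrable_smul_coe hg)

theorem inner_J {f : S d → ℝ} (hf : Continuous f) (v : E d) :
    ⟪v, J f⟫_ℝ = ∫ ω, ⟪(ω : E d), v⟫_ℝ * f ω ∂(unif d) := by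
  rw [J, ← integral_inner (integrable_smul_coe hf)]
  refine integral_congr_ae (.of_forall fun ω => ?_)
  simp only [inner_smul_right, real_inner_comm]
  ring

theorem norm_J_le (h : C(S d, ℝ)) : ‖J (h : S d → ℝ)‖ ≤ ‖h‖ := by
  have := norm_integral_le_of_norm_le_const (μ := unif d) (f := fun ω : S d => h ω • (ω : E d))
    (C := ‖h‖) (.of_forall fun ω => by
      rw [norm_smul, norm_coe_S, mul_one]; exact h.norm_coe_le_norm ω)
  simpa [J] using this

theorem eq_zero_of_integral_eq_zero {F : S d → ℝ} (hF : Continuous F) (hF0 : ∀ ω, 0 ≤ F ω)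
    (h : ∫ ω, F ω ∂(unif d) = 0) : F = 0 :=
  (hF.ae_eq_iff_eq (unif d) continuous_const).mp
    ((integral_eq_zero_iff_of_nonneg hF0 (integrable_unif hF _)).mp h)

/-- Integration against a probability measure, as a functional on `C⁰`. -/
noncomputable def integralCLM (μ : Measure (S d)) [IsProbabilityMeasure μ] :
    C(S d, ℝ) →L[ℝ] ℝ :=
  LinearMap.mkContinuous
    { toFun := fun h => ∫ ω, h ω ∂μ
      map_add' := fun h k =>
        integral_add (integrable_unif h.continuous μ) (integrable_unif k.continuous μ)
      map_smul' := fun c _ => integral_const_mul c _ } 1 fun h => by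
    have := norm_integral_le_of_norm_le_const (μ := μ) (f := fun ω : S d => h ω)
      (C := ‖h‖) (.of_forall fun ω => h.norm_coe_le_norm ω)
    simpa using this

/-- Integration against a continuous function, as a functional on `C⁰`. -/
noncomputable def mulIntegralCLM (φ : C(S d, ℝ)) : C(S d, ℝ) →L[ℝ] ℝ :=
  (integralCLM (unif d)).comp (ContinuousLinearMap.mul ℝ C(S d, ℝ) φ)

theorem mulIntegralCLM_apply (φ h : C(S d, ℝ)) :
    mulIntegralCLM φ h = ∫ ω, φ ω * h ω ∂(unif d) := rfl

theorem continuous_chemPot {σ : ℝ} {f : S d → ℝ} (hf : Continuous f) (hf0 : ∀ ω, 0 < f ω) :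
    Continuous (chemPot σ f) :=
  (continuous_const.mul (hf.log fun ω => (hf0 ω).ne')).sub
    (continuous_subtype_val.inner continuous_const)

theorem exists_pos_lower_bound {f : S d → ℝ} (hf : Continuous f) (hf0 : ∀ ω, 0 < f ω) :
    ∃ m > 0, ∀ ω, m ≤ f ω := by
  have hne : Nonempty (S d) := ⟨toS (EuclideanSpace.single 0 1) (by simp)⟩
  obtain ⟨ω₀, h⟩ := hf.exists_forall_le_of_hasCompactSupport (HasCompactSupport.of_compactSpace f)
  exact ⟨f ω₀, hf0 ω₀, h⟩

/-- The differential of the free energy on perturbations of zero mean. -/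
theorem hasFDerivAt_freeEnergy {σ : ℝ} (hσ : 0 < σ) {f : S d → ℝ} (hf : Continuous f)
    (hf0 : ∀ ω, 0 < f ω) :
    HasFDerivAt (fun h : meanZero d => freeEnergy σ (fun ω => f ω + (h : C(S d, ℝ)) ω))
      ((mulIntegralCLM ⟨chemPot σ f, continuous_chemPot hf hf0⟩).comp (meanZero d).subtypeL) 0 := by
  obtain ⟨m, hm, hmf⟩ := exists_pos_lower_bound hf hf0
  refine (hasFDerivAt_iff_isLittleO_nhds_zero (𝕜 := ℝ) (E := meanZero d) (F := ℝ)).mpr ?_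
  refine Asymptotics.IsBigO.trans_isLittleO (g := fun h : meanZero d => ‖h‖ ^ 2) ?_
    (Asymptotics.isLittleO_norm_pow_id one_lt_two)
  -- The entropy remainder contributes `σ / m`, where `m` bounds `f` from below, and `‖J[h]‖² / 2 ≤
  -- ‖h‖² / 2` contributes the rest. For `‖h‖ < m` the perturbed density stays positive.
  refine Asymptotics.IsBigO.of_bound (σ / m + 1 / 2) ?_
  filter_upwards [ball_mem_nhds (0 : meanZero d) hm] with h hh
  have hhm : ‖(h : C(S d, ℝ))‖ < m := by simpa using hh
  have hpos : ∀ ω, 0 < f ω + (h : C(S d, ℝ)) ω := fun ω => by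
    have h1 := neg_le_of_abs_le ((h : C(S d, ℝ)).norm_coe_le_norm ω)
    linarith [hmf ω]
  set k : C(S d, ℝ) := (h : C(S d, ℝ)) with hk
  have hk0 : ∫ ω, k ω ∂(unif d) = 0 := h.2
  let R : S d → ℝ := fun ω => (f ω + k ω) * Real.log (f ω + k ω) - f ω * Real.log (f ω) -
    (Real.log (f ω) + 1) * k ω
  have hlogf : Continuous fun ω => Real.log (f ω) := hf.log fun ω => (hf0 ω).ne'
  have hfk : Continuous fun ω => f ω + k ω := hf.fun_add k.continuous
  have i1 := integrable_unif (hfk.fun_mul (hfk.log fun ω => (hpos ω).ne')) (unif d)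
  have i2 := integrable_unif (hf.fun_mul hlogf) (unif d)
  have i3 := integrable_unif (hlogf.fun_mul k.continuous) (unif d)
  have i4 := integrable_unif k.continuous (unif d)
  have i6 : Integrable
      (fun ω => (f ω + k ω) * Real.log (f ω + k ω) - f ω * Real.log (f ω)) (unif d) := i1.sub i2
  have i5 : Integrable (fun ω : S d => ⟪(ω : E d), J f⟫_ℝ * k ω) (unif d) :=
    integrable_unif ((continuous_subtype_val.inner continuous_const).fun_mul k.continuous) _
  have hRint : ∫ ω, R ω ∂(unif d) =
      ((∫ ω, (f ω + k ω) * Real.log (f ω + k ω) ∂(unif d)) -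
        ∫ ω, f ω * Real.log (f ω) ∂(unif d)) - ∫ ω, Real.log (f ω) * k ω ∂(unif d) := by
    have : ∀ ω, R ω = (f ω + k ω) * Real.log (f ω + k ω) - f ω * Real.log (f ω) -
      (Real.log (f ω) * k ω + k ω) := fun ω => by simp only [R]; ring
    simp_rw [this]
    rw [integral_sub i6 (i3.fun_add i4), integral_sub i1 i2, integral_add i3 i4, hk0, add_zero]
  have hΛ : ∫ ω, chemPot σ f ω * k ω ∂(unif d) =
      σ * (∫ ω, Real.log (f ω) * k ω ∂(unif d)) - ⟪J f, J (k : S d → ℝ)⟫_ℝ := by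
    rw [inner_J k.continuous, ← integral_const_mul, ← integral_sub (i3.const_mul σ) i5]
    refine integral_congr_ae (.of_forall fun ω => ?_)
    simp only [chemPot]; ring
  have hJ : ‖J (fun ω => f ω + k ω)‖ ^ 2 =
      ‖J f‖ ^ 2 + 2 * ⟪J f, J (k : S d → ℝ)⟫_ℝ + ‖J (k : S d → ℝ)‖ ^ 2 := by
    rw [J_add hf k.continuous, norm_add_sq_real]
  have hval : freeEnergy σ (fun ω => f ω + k ω) - freeEnergy σ f -
      ∫ ω, chemPot σ f ω * k ω ∂(unif d) =
      σ * (∫ ω, R ω ∂(unif d)) - ‖J (k : S d → ℝ)‖ ^ 2 / 2 := by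
    rw [hRint, hΛ, freeEnergy, freeEnergy, hJ]; ring
  have hR : |∫ ω, R ω ∂(unif d)| ≤ ‖k‖ ^ 2 / m := by
    have := norm_integral_le_of_norm_le_const (μ := unif d) (f := R)
      (C := ‖k‖ ^ 2 / m) (.of_forall fun ω => by
        have h1 := mul_log_remainder (hf0 ω) (hpos ω)
        rw [add_sub_cancel_left] at h1
        refine h1.trans ?_
        have h2 : k ω ^ 2 ≤ ‖k‖ ^ 2 := by
          rw [← sq_abs]
          exact pow_le_pow_left₀ (abs_nonneg _) (k.norm_coe_le_norm ω) 2
        exact div_le_div₀ (by positivity) h2 hm (hmf ω))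
    simpa using this
  have hgoal : (fun h : meanZero d => freeEnergy σ (fun ω => f ω + (h : C(S d, ℝ)) ω)) (0 + h) -
      (fun h : meanZero d => freeEnergy σ (fun ω => f ω + (h : C(S d, ℝ)) ω)) 0 -
      ((mulIntegralCLM ⟨chemPot σ f, continuous_chemPot hf hf0⟩).comp (meanZero d).subtypeL) h =
      σ * (∫ ω, R ω ∂(unif d)) - ‖J (k : S d → ℝ)‖ ^ 2 / 2 := by
    rw [← hval]
    simp [mulIntegralCLM_apply, ← hk]
  rw [hgoal]
  have hn : ‖h‖ = ‖k‖ := rfl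
  rw [hn, Real.norm_eq_abs, Real.norm_of_nonneg (sq_nonneg ‖k‖)]
  have hJk : ‖J (k : S d → ℝ)‖ ^ 2 ≤ ‖k‖ ^ 2 :=
    pow_le_pow_left₀ (norm_nonneg _) (norm_J_le k) 2
  calc |σ * (∫ ω, R ω ∂(unif d)) - ‖J (k : S d → ℝ)‖ ^ 2 / 2|
      ≤ |σ * ∫ ω, R ω ∂(unif d)| + |‖J (k : S d → ℝ)‖ ^ 2 / 2| := abs_sub _ _
    _ = σ * |∫ ω, R ω ∂(unif d)| + ‖J (k : S d → ℝ)‖ ^ 2 / 2 := by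
        rw [abs_mul, abs_of_pos hσ,
          abs_of_nonneg (a := ‖J (k : S d → ℝ)‖ ^ 2 / 2) (by positivity)]
    _ ≤ σ * (‖k‖ ^ 2 / m) + ‖k‖ ^ 2 / 2 := by gcongr
    _ = (σ / m + 1 / 2) * ‖k‖ ^ 2 := by ring

theorem isConstrainedCritical_iff {σ : ℝ} (hσ : 0 < σ) {f : S d → ℝ} (hf : Continuous f)
    (hf0 : ∀ ω, 0 < f ω) (hf1 : ∫ ω, f ω ∂(unif d) = 1) :
    IsConstrainedCritical σ f ↔ ∃ C : ℝ, ∀ ω, chemPot σ f ω = C := by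
  have hD := hasFDerivAt_freeEnergy hσ hf hf0
  set φ : C(S d, ℝ) := ⟨chemPot σ f, continuous_chemPot hf hf0⟩ with hφ
  constructor
  · rintro ⟨-, h0⟩
    have h1 := hD.unique h0
    set c := ∫ ω, φ ω ∂(unif d) with hc
    -- The chemical potential minus its mean is an admissible direction, and the differential there
    -- is its squared `L²` norm.
    let k : C(S d, ℝ) := φ - ContinuousMap.const _ c
    have iφ := integrable_unif φ.continuous (unif d)
    have hk : ∫ ω, k ω ∂(unif d) = 0 := by
      simp only [k, ContinuousMap.sub_apply, ContinuousMap.const_apply]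
      rw [integral_sub iφ (integrable_const c), ← hc]
      simp
    have h2 : ∫ ω, φ ω * k ω ∂(unif d) = 0 := by
      have := DFunLike.congr_fun h1 (⟨k, hk⟩ : meanZero d)
      simpa [mulIntegralCLM_apply] using this
    have h3 : ∫ ω, k ω * k ω ∂(unif d) = 0 := by
      have e : ∀ ω, k ω * k ω = φ ω * k ω - c * k ω := fun ω => by
        simp only [k, ContinuousMap.sub_apply, ContinuousMap.const_apply]; ring
      simp_rw [e]
      rw [integral_sub (integrable_unif (φ.continuous.fun_mul k.continuous) _)
        ((integrable_unif k.continuous _).const_mul c), integral_const_mul, h2, hk]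
      simp
    have h4 : (fun ω => k ω * k ω) = 0 := eq_zero_of_integral_eq_zero
      (k.continuous.fun_mul k.continuous) (fun ω => mul_self_nonneg _) h3
    refine ⟨c, fun ω => ?_⟩
    have h5 : k ω = 0 := mul_self_eq_zero.mp (congrFun h4 ω)
    exact sub_eq_zero.mp h5
  · rintro ⟨C, hC⟩
    refine ⟨hf1, ?_⟩
    convert hD using 1
    ext h
    have h0 : ∫ ω, (h : C(S d, ℝ)) ω ∂(unif d) = 0 := h.2
    simp [mulIntegralCLM_apply, hφ, hC, integral_const_mul, h0]

/-! ### The algebra of smooth functions -/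

/-- The algebra of smooth functions on the sphere. -/
def smoothAlg (d : ℕ) : Subalgebra ℝ (S d → ℝ) where
  carrier := {f | IsC ⊤ f}
  mul_mem' := fun hf hg => IsC.mul hf hg
  add_mem' := fun hf hg => IsC.add hf hg
  algebraMap_mem' := fun c => isC_const ⊤ c

/-- The type of smooth functions on the sphere. -/
def Sm (d : ℕ) : Type := smoothAlg d

noncomputable instance : CommRing (Sm d) := inferInstanceAs (CommRing (smoothAlg d))

noncomputable instance : Algebra ℝ (Sm d) := inferInstanceAs (Algebra ℝ (smoothAlg d))

instance : FunLike (Sm d) (S d) ℝ where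
  coe f := f.1
  coe_injective := Subtype.val_injective

theorem Sm.ext {f g : Sm d} (h : ∀ ω, f ω = g ω) : f = g := DFunLike.ext f g h

theorem Sm.add_apply (f g : Sm d) (ω : S d) : (f + g) ω = f ω + g ω := rfl

theorem Sm.sub_apply (f g : Sm d) (ω : S d) : (f - g) ω = f ω - g ω := rfl

theorem Sm.mul_apply (f g : Sm d) (ω : S d) : (f * g) ω = f ω * g ω := rfl

theorem Sm.smul_apply (c : ℝ) (f : Sm d) (ω : S d) : (c • f) ω = c * f ω := rfl

theorem Sm.one_apply (ω : S d) : (1 : Sm d) ω = 1 := rfl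

theorem Sm.zero_apply (ω : S d) : (0 : Sm d) ω = 0 := rfl

theorem Sm.isC (f : Sm d) : IsC ⊤ (f : S d → ℝ) := f.2

theorem Sm.continuous (f : Sm d) : Continuous (f : S d → ℝ) := f.isC.continuous

theorem Sm.diffAt (f : Sm d) (ω : S d) : DiffAt (f : S d → ℝ) ω := f.isC.diffAt le_top ω

/-- The Cartesian components of the tangential gradient, as derivations. -/
noncomputable def D (i : Fin (d + 1)) : Derivation ℝ (Sm d) (Sm d) :=
  Derivation.mk'
    { toFun := fun f => ⟨pd i f, isC_pd_top f.isC i⟩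
      map_add' := fun f g => by
        refine Sm.ext fun ω => ?_
        exact pd_add (f.diffAt ω) (g.diffAt ω) i
      map_smul' := fun c f => by
        refine Sm.ext fun ω => ?_
        exact pd_const_mul (f.diffAt ω) c i }
    fun f g => by
      refine Sm.ext fun ω => ?_
      exact pd_mul (f.diffAt ω) (g.diffAt ω) i

theorem D_apply (i : Fin (d + 1)) (f : Sm d) (ω : S d) :
    D i f ω = pd i (f : S d → ℝ) ω := rfl

theorem D_mul (i : Fin (d + 1)) (f g : Sm d) : D i (f * g) = f * D i g + g * D i f := by
  rw [Derivation.leibniz]; rfl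

/-- The coordinate functions. -/
def X (i : Fin (d + 1)) : Sm d := ⟨coord i, isC_coord ⊤ i⟩

theorem sum_apply {ι : Type*} (s : Finset ι) (f : ι → Sm d) (ω : S d) :
    (∑ i ∈ s, f i) ω = ∑ i ∈ s, f i ω := by
  classical
  induction s using Finset.induction_on with
  | empty => simp [Sm.zero_apply]
  | insert a s ha ih => rw [Finset.sum_insert ha, Finset.sum_insert ha, Sm.add_apply, ih]

theorem D_X (i j : Fin (d + 1)) : D i (X j) = (if i = j then 1 else 0) - X j * X i := by
  refine Sm.ext fun ω => ?_
  have h := pd_coord i j ω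
  split_ifs with hij
  · rw [if_pos hij] at h; exact h
  · rw [if_neg hij] at h; exact h

theorem sum_X_mul_X : ∑ i, X i * X i = (1 : Sm d) := by
  refine Sm.ext fun ω => ?_
  rw [sum_apply]
  exact sum_coord_sq ω

theorem sum_X_mul_D (f : Sm d) : ∑ i, X i * D i f = 0 := by
  refine Sm.ext fun ω => ?_
  rw [sum_apply]
  exact sum_coord_mul_pd (f.diffAt ω)

/-- The Laplace–Beltrami operator. -/
noncomputable def Lap : Sm d →ₗ[ℝ] Sm d := ∑ i, (D i).toLinearMap ∘ₗ (D i).toLinearMap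

theorem Lap_eq (f : Sm d) : Lap f = ∑ i, D i (D i f) := by
  simp [Lap, LinearMap.sum_apply]

theorem sphLaplacian_eq_Lap (f : Sm d) (ω : S d) :
    sphLaplacian (f : S d → ℝ) ω = Lap f ω := by
  rw [sphLaplacian_eq_sum (f.isC.of_le le_top), Lap_eq, sum_apply]
  rfl

theorem Lap_mul (f g : Sm d) :
    Lap (f * g) = f * Lap g + 2 * ∑ i, D i f * D i g + g * Lap f := by
  simp only [Lap_eq, Finset.mul_sum, ← Finset.sum_add_distrib, D_mul, map_add]
  exact Finset.sum_congr rfl fun i _ => by ring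

theorem Lap_X (j : Fin (d + 1)) : Lap (X j) = -((d : ℝ) • X j) := by
  have h : ∀ i : Fin (d + 1), D i (D i (X j)) =
      -X j + 2 * X j * (X i * X i) - (if i = j then X i else 0) := fun i => by
    have h0 : D i (if i = j then (1 : Sm d) else 0) = 0 := by split_ifs <;> simp
    rw [D_X, map_sub, D_mul, D_X, D_X, h0, if_pos rfl]
    split_ifs <;> ring
  rw [Lap_eq]
  simp_rw [h]
  rw [Finset.sum_sub_distrib, Finset.sum_add_distrib, ← Finset.mul_sum, sum_X_mul_X]
  simp only [Finset.sum_const, Finset.card_univ, Fintype.card_fin, Finset.sum_ite_eq',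
    Finset.mem_univ, if_true, Nat.cast_smul_eq_nsmul, add_smul, one_smul]
  rw [smul_neg]
  ring

theorem sum_D_mul_D_X (f : Sm d) (j : Fin (d + 1)) : ∑ i, D i f * D i (X j) = D j f := by
  have h : ∀ i, D i f * D i (X j) = (if i = j then D i f else 0) - X j * (X i * D i f) :=
    fun i => by rw [D_X]; split_ifs <;> ring
  simp_rw [h]
  rw [Finset.sum_sub_distrib, ← Finset.mul_sum, sum_X_mul_D]
  simp

theorem Lap_mul_X (f : Sm d) (j : Fin (d + 1)) :
    Lap (f * X j) = Lap f * X j + 2 * D j f - (d : ℝ) • (f * X j) := by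
  rw [Lap_mul, sum_D_mul_D_X, Lap_X, mul_neg, mul_smul_comm]
  ring

/-! ### The integral -/

/-- The integral of a smooth function. -/
noncomputable def integ : Sm d →ₗ[ℝ] ℝ where
  toFun f := ∫ ω, f ω ∂(unif d)
  map_add' f g := integral_add (integrable_unif f.continuous _) (integrable_unif g.continuous _)
  map_smul' c _ := integral_const_mul c _

theorem integ_apply (f : Sm d) : integ f = ∫ ω, f ω ∂(unif d) := rfl

theorem integ_D (i : Fin (d + 1)) (f : Sm d) : integ (D i f) = d * integ (X i * f) :=
  integral_pd (f.isC.of_le le_top) i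

theorem integ_D_mul (i : Fin (d + 1)) (f g : Sm d) :
    integ (D i f * g) = -integ (f * D i g) + d * integ (X i * (f * g)) := by
  have h := integ_D i (f * g)
  rw [D_mul, map_add] at h
  rw [mul_comm (D i f) g]
  linarith

theorem integ_Lap_mul (f g : Sm d) : integ (Lap f * g) = -integ (∑ i, D i f * D i g) := by
  have h : ∀ i, integ (D i (D i f) * g) = -integ (D i f * D i g) + d * integ (X i * D i f * g) :=
    fun i => by rw [integ_D_mul, mul_assoc]
  rw [Lap_eq, Finset.sum_mul, map_sum, map_sum]
  simp_rw [h]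
  rw [Finset.sum_add_distrib, Finset.sum_neg_distrib, ← Finset.mul_sum,
    ← map_sum integ (fun i => X i * D i f * g), ← Finset.sum_mul, sum_X_mul_D]
  simp

/-- The generators of rotations. -/
noncomputable def rot (i j : Fin (d + 1)) : Derivation ℝ (Sm d) (Sm d) := X i • D j - X j • D i

theorem rot_apply (i j : Fin (d + 1)) (f : Sm d) : rot i j f = X i * D j f - X j * D i f := rfl

/-- Rotations preserve the uniform measure. Algebraically, the terms `d X i` in the adjoints of the
`D i` cancel by antisymmetry. -/
theorem integ_rot (i j : Fin (d + 1)) (f : Sm d) : integ (rot i j f) = 0 := by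
  have h1 := integ_D_mul j f (X i)
  have h2 := integ_D_mul i f (X j)
  have e : D j (X i) = D i (X j) := by
    rw [D_X, D_X, mul_comm]; simp only [eq_comm]
  have e1 : D j f * X i = X i * D j f := mul_comm _ _
  have e2 : D i f * X j = X j * D i f := mul_comm _ _
  have e3 : X j * (f * X i) = X i * (f * X j) := by ring
  rw [e, e1, e3] at h1
  rw [e2] at h2
  rw [rot_apply, map_sub, h1, h2, sub_self]

/-! ### Spherical polynomials -/

/-- Restrictions to the sphere of affine functions. -/
noncomputable def affine (d : ℕ) : Submodule ℝ (Sm d) := Submodule.span ℝ (insert 1 (Set.range X))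

/-- Restrictions to the sphere of polynomials of degree less than `l`. -/
noncomputable def pol (d : ℕ) : ℕ → Submodule ℝ (Sm d)
  | 0 => ⊥
  | l + 1 => affine d ^ l

theorem one_mem_affine : (1 : Sm d) ∈ affine d := Submodule.subset_span (Set.mem_insert _ _)

theorem X_mem_affine (i : Fin (d + 1)) : X i ∈ affine d :=
  Submodule.subset_span (Set.mem_insert_of_mem _ ⟨i, rfl⟩)

theorem mul_mem_pol {l : ℕ} {p y : Sm d} (hp : p ∈ pol d l) (hy : y ∈ affine d) :
    p * y ∈ pol d (l + 1) := by
  cases l with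
  | zero =>
    have : p = 0 := by simpa [pol] using hp
    simp [this]
  | succ l =>
    change p * y ∈ affine d ^ (l + 1)
    rw [pow_succ]
    exact Submodule.mul_mem_mul hp hy

theorem mul_X_mem_pol {l : ℕ} {p : Sm d} (hp : p ∈ pol d l) (i : Fin (d + 1)) :
    p * X i ∈ pol d (l + 1) := mul_mem_pol hp (X_mem_affine i)

theorem X_mul_mem_pol {l : ℕ} {p : Sm d} (hp : p ∈ pol d l) (i : Fin (d + 1)) :
    X i * p ∈ pol d (l + 1) := by
  rw [mul_comm]; exact mul_X_mem_pol hp i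

theorem pol_le_succ (l : ℕ) : pol d l ≤ pol d (l + 1) := fun p hp => by
  simpa using mul_mem_pol hp one_mem_affine

theorem pol_mono : Monotone (pol d) := monotone_nat_of_le_succ pol_le_succ

theorem one_mem_pol : (1 : Sm d) ∈ pol d 1 := by
  change (1 : Sm d) ∈ affine d ^ 0
  rw [pow_zero]; exact Submodule.one_le.mp le_rfl

theorem pol_one_induction {C : Sm d → Prop} (h0 : ∀ c : ℝ, C (c • 1))
    {p : Sm d} (hp : p ∈ pol d 1) : C p := by
  change p ∈ affine d ^ 0 at hp
  rw [pow_zero, Submodule.mem_one] at hp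
  obtain ⟨c, rfl⟩ := hp
  rw [Algebra.algebraMap_eq_smul_one]
  exact h0 c

/-- Polynomials of degree at most `l + 1` are sums of products of one of degree at most `l` with `1`
or a coordinate, so an additive property need only be checked on those. -/
theorem pol_succ_induction {l : ℕ} {C : Sm d → Prop} (h1 : ∀ q ∈ pol d (l + 1), C q)
    (hX : ∀ q ∈ pol d (l + 1), ∀ j, C (q * X j)) (hadd : ∀ p q, C p → C q → C (p + q))
    {p : Sm d} (hp : p ∈ pol d (l + 1 + 1)) : C p := by
  change p ∈ affine d ^ (l + 1) at hp
  rw [pow_succ] at hp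
  refine Submodule.mul_induction_on hp (fun q hq y hy => ?_) hadd
  replace hq : q ∈ pol d (l + 1) := hq
  clear hp
  induction hy using Submodule.span_induction generalizing q with
  | mem y hy =>
    rcases hy with rfl | ⟨j, rfl⟩
    · rw [mul_one]; exact h1 q hq
    · exact hX q hq j
  | zero => rw [mul_zero]; exact h1 0 (zero_mem _)
  | add y z _ _ hy hz => rw [mul_add]; exact hadd _ _ (hy q hq) (hz q hq)
  | smul c y _ hy =>
    rw [mul_smul_comm, ← smul_mul_assoc]
    exact hy _ (Submodule.smul_mem _ c hq)

/-- If `p` restricts a homogeneous polynomial `P` of degree `l`, the tangential gradient is `∇P - l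
P x` on the sphere, so the sum is `∂ᵢ P`. Terms of lower degree gain at most one degree. -/
theorem D_add_mem_pol (i : Fin (d + 1)) {l : ℕ} {p : Sm d} (hp : p ∈ pol d (l + 1)) :
    D i p + (l : ℝ) • (X i * p) ∈ pol d (l + 1) := by
  induction l generalizing p with
  | zero =>
    refine pol_one_induction (C := fun p => D i p + ((0 : ℕ) : ℝ) • (X i * p) ∈ pol d 1)
      (fun c => ?_) hp
    simp
  | succ l ih =>
    refine pol_succ_induction
      (C := fun p => D i p + ((l + 1 : ℕ) : ℝ) • (X i * p) ∈ pol d (l + 1 + 1)) ?_ ?_ ?_ hp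
    · intro q hq
      have e : D i q + ((l + 1 : ℕ) : ℝ) • (X i * q) = (D i q + (l : ℝ) • (X i * q)) + X i * q := by
        push_cast; rw [add_smul, one_smul]; ring
      rw [e]
      exact add_mem (pol_le_succ _ (ih hq)) (X_mul_mem_pol hq i)
    · intro q hq j
      have e : D i (q * X j) + ((l + 1 : ℕ) : ℝ) • (X i * (q * X j)) =
          (D i q + (l : ℝ) • (X i * q)) * X j + (if i = j then q else 0) := by
        push_cast
        rw [D_mul, D_X, add_smul, one_smul, add_mul, smul_mul_assoc, mul_assoc (X i)]
        split_ifs <;> ring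
      rw [e]
      refine add_mem (mul_X_mem_pol (ih hq) j) ?_
      split_ifs
      · exact pol_le_succ _ hq
      · exact zero_mem _
    · intro p q hp hq
      have e : D i (p + q) + ((l + 1 : ℕ) : ℝ) • (X i * (p + q)) =
          (D i p + ((l + 1 : ℕ) : ℝ) • (X i * p)) + (D i q + ((l + 1 : ℕ) : ℝ) • (X i * q)) := by
        rw [map_add, mul_add, smul_add]; ring
      rw [e]
      exact add_mem hp hq

theorem D_mem_pol (i : Fin (d + 1)) {l : ℕ} {p : Sm d} (hp : p ∈ pol d l) :
    D i p ∈ pol d (l + 1) := by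
  cases l with
  | zero =>
    have : p = 0 := by simpa [pol] using hp
    simp [this]
  | succ l =>
    have h := sub_mem (pol_le_succ _ (D_add_mem_pol i hp))
      (Submodule.smul_mem _ (l : ℝ) (X_mul_mem_pol hp i))
    rwa [add_sub_cancel_right] at h

/-- Minus the eigenvalue of the Laplace–Beltrami operator on spherical harmonics of degree `l`. -/
def eig (d l : ℕ) : ℝ := l * (l + d - 1)

/-- The Laplacian is triangular for the degree filtration, with diagonal entries `-eig d l`. The
induction multiplies by a coordinate and uses `eig d (l + 1) = eig d l + 2 l + d`; the cross term is
absorbed by `D_add_mem_pol`. -/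
theorem Lap_add_mem_pol {l : ℕ} {p : Sm d} (hp : p ∈ pol d (l + 1)) :
    Lap p + eig d l • p ∈ pol d l := by
  induction l generalizing p with
  | zero =>
    refine pol_one_induction (C := fun p => Lap p + eig d 0 • p ∈ pol d 0) (fun c => ?_) hp
    simp [eig, Lap_eq]
  | succ l ih =>
    refine pol_succ_induction (C := fun p => Lap p + eig d (l + 1) • p ∈ pol d (l + 1)) ?_ ?_ ?_ hp
    · intro q hq
      have e : Lap q + eig d (l + 1) • q =
          (Lap q + eig d l • q) + (eig d (l + 1) - eig d l) • q := by
        rw [sub_smul]; ring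
      rw [e]
      exact add_mem (pol_le_succ _ (ih hq)) (Submodule.smul_mem _ _ hq)
    · intro q hq j
      have h1 : eig d (l + 1) = eig d l + 2 * l + d := by simp only [eig]; push_cast; ring
      have e : Lap (q * X j) + eig d (l + 1) • (q * X j) =
          (Lap q + eig d l • q) * X j + (2 : ℝ) • (D j q + (l : ℝ) • (X j * q)) := by
        have h2 : (2 : ℝ) • D j q = 2 * D j q := by
          rw [two_smul]; ring
        rw [Lap_mul_X, h1, smul_add, h2, smul_smul, add_smul, add_smul, add_mul, smul_mul_assoc,
          mul_comm (X j) q]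
        ring
      rw [e]
      exact add_mem (mul_X_mem_pol (ih hq) j) (Submodule.smul_mem _ _ (D_add_mem_pol j hq))
    · intro p q hp hq
      have e : Lap (p + q) + eig d (l + 1) • (p + q) =
          (Lap p + eig d (l + 1) • p) + (Lap q + eig d (l + 1) • q) := by
        rw [map_add, smul_add]; ring
      rw [e]
      exact add_mem hp hq

theorem rot_mem_pol (i j : Fin (d + 1)) {l : ℕ} {p : Sm d} (hp : p ∈ pol d l) :
    rot i j p ∈ pol d l := by
  cases l with
  | zero =>
    have : p = 0 := by simpa [pol] using hp
    simp [this]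
  | succ l =>
    induction l generalizing p with
    | zero =>
      refine pol_one_induction (C := fun p => rot i j p ∈ pol d 1) (fun c => ?_) hp
      simp
    | succ l ih =>
      refine pol_succ_induction (C := fun p => rot i j p ∈ pol d (l + 1 + 1)) ?_ ?_ ?_ hp
      · intro q hq
        exact pol_le_succ _ (ih hq)
      · intro q hq k
        have e : rot i j (q * X k) = rot i j q * X k +
            q * ((if j = k then X i else 0) - (if i = k then X j else 0)) := by
          simp only [rot_apply, D_mul, D_X]
          split_ifs <;> ring
        rw [e]
        refine add_mem (mul_X_mem_pol (ih hq) k) (mul_mem_pol hq ?_)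
        refine sub_mem ?_ ?_ <;> split_ifs
        exacts [X_mem_affine i, zero_mem _, X_mem_affine j, zero_mem _]
      · intro p q hp hq
        rw [map_add]
        exact add_mem hp hq

theorem exists_pol_card (d l : ℕ) : ∃ s : Finset (Sm d), s.card ≤ (d + 2) ^ l ∧
    pol d (l + 1) = Submodule.span ℝ (s : Set (Sm d)) := by
  classical
  let s : Finset (Sm d) := insert 1 (Finset.univ.image X)
  have hs : s.card ≤ d + 2 := by
    refine (Finset.card_insert_le _ _).trans ?_
    have := Finset.card_image_le (s := (Finset.univ : Finset (Fin (d + 1)))) (f := X)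
    rw [Finset.card_univ, Fintype.card_fin] at this
    omega
  let _ := Finset.monoid (α := Sm d)
  refine ⟨s ^ l, Finset.card_pow_le.trans (Nat.pow_le_pow_left hs l), ?_⟩
  change affine d ^ l = _
  rw [affine, Submodule.span_pow, Finset.coe_pow]
  simp [s]

instance (d l : ℕ) : FiniteDimensional ℝ (pol d l) := by
  cases l with
  | zero => change FiniteDimensional ℝ (⊥ : Submodule ℝ (Sm d)); infer_instance
  | succ l =>
    obtain ⟨s, -, hs⟩ := exists_pol_card d l
    rw [hs]
    exact FiniteDimensional.span_finset ℝ s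

theorem finrank_pol_le (d l : ℕ) : Module.finrank ℝ (pol d (l + 1)) ≤ (d + 2) ^ l := by
  obtain ⟨s, h1, hs⟩ := exists_pol_card d l
  rw [hs]
  exact (finrank_span_finset_le_card s).trans h1

/-! ### The `L²` structure -/

/-- The `L²` inner product of smooth functions. -/
@[reducible]
noncomputable def smoothCore (d : ℕ) : InnerProductSpace.Core ℝ (Sm d) where
  inner f g := integ (f * g)
  conj_inner_symm f g := by simp [mul_comm]
  re_inner_nonneg f := integral_nonneg fun ω => mul_self_nonneg (f ω)
  add_left f g h := by simp [add_mul]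
  smul_left f g c := by simp
  definite f h := by
    have h1 := eq_zero_of_integral_eq_zero (f.continuous.fun_mul f.continuous)
      (fun ω => mul_self_nonneg (f ω)) h
    exact Sm.ext fun ω => mul_self_eq_zero.mp (congrFun h1 ω)

noncomputable instance : NormedAddCommGroup (Sm d) :=
  @InnerProductSpace.Core.toNormedAddCommGroup ℝ (Sm d) _ _ _ (smoothCore d)

noncomputable instance : InnerProductSpace ℝ (Sm d) :=
  InnerProductSpace.ofCore (smoothCore d).toCore

theorem inner_eq (f g : Sm d) : ⟪f, g⟫_ℝ = integ (f * g) := rfl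

theorem norm_sq_eq (f : Sm d) : ‖f‖ ^ 2 = integ (f * f) := by
  rw [← real_inner_self_eq_norm_sq, inner_eq]

/-! ### Pointwise bounds for spherical polynomials -/

/-- The rotations span the tangent space: `∑ X i * rot i j` recovers `D j`. -/
theorem eq_const_of_rot_eq_zero (hd : 1 ≤ d) {K : Sm d} (hK : ∀ i j, rot i j K = 0) (ω : S d) :
    K ω = integ K := by
  have hD : ∀ j, D j K = 0 := fun j => by
    have h1 : ∑ i, X i * rot i j K = D j K := by
      have e : ∀ i, X i * rot i j K = (X i * X i) * D j K - X j * (X i * D i K) := fun i => by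
        rw [rot_apply]; ring
      simp_rw [e]
      rw [Finset.sum_sub_distrib, ← Finset.sum_mul, ← Finset.mul_sum, sum_X_mul_X, sum_X_mul_D]
      ring
    rw [← h1]
    simp [hK]
  have hc := exists_const_of_pd_eq_zero hd (fun ω => K.diffAt ω) (fun i ω => by
    rw [← D_apply, hD, Sm.zero_apply])
  rw [integ_apply, integral_congr_ae (g := fun _ => K ω) (.of_forall fun η => hc η ω)]
  simp

theorem sum_repr_pol {V : Submodule ℝ (Sm d)} {m : ℕ} (b : OrthonormalBasis (Fin m) ℝ V)
    {p : Sm d} (hp : p ∈ V) : ∑ k, ⟪(b k : Sm d), p⟫_ℝ • (b k : Sm d) = p := by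
  have := congrArg Subtype.val (b.sum_repr' ⟨p, hp⟩)
  simpa using this

/-- The sum is the reproducing kernel of `pol d l` on the diagonal. Rotations act on `pol d l` by
skew matrices, so they annihilate it; it is constant, and its integral is the dimension. -/
theorem sum_basis_mul_self (hd : 1 ≤ d) {l m : ℕ} (b : OrthonormalBasis (Fin m) ℝ (pol d l))
    (ω : S d) : ∑ k, (b k : Sm d) ω ^ 2 = m := by
  let K : Sm d := ∑ k, (b k : Sm d) * (b k : Sm d)
  have hrot : ∀ i j, rot i j K = 0 := fun i j => by
    have hskew : ∀ k n, ⟪(b n : Sm d), rot i j (b k : Sm d)⟫_ℝ =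
        -⟪(b k : Sm d), rot i j (b n : Sm d)⟫_ℝ := fun k n => by
      have h := integ_rot i j ((b k : Sm d) * (b n : Sm d))
      rw [Derivation.leibniz, map_add] at h
      simp only [smul_eq_mul] at h
      rw [inner_eq, inner_eq]
      linarith
    have h1 : ∀ k, (b k : Sm d) * rot i j (b k : Sm d) =
        ∑ n, ⟪(b n : Sm d), rot i j (b k : Sm d)⟫_ℝ • ((b n : Sm d) * (b k : Sm d)) := fun k => by
      conv_lhs => rw [← sum_repr_pol b (rot_mem_pol i j (b k).2), Finset.mul_sum]
      exact Finset.sum_congr rfl fun n _ => by rw [mul_smul_comm, mul_comm]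
    have h2 : ∑ k, (b k : Sm d) * rot i j (b k : Sm d) =
        -∑ k, (b k : Sm d) * rot i j (b k : Sm d) := by
      conv_lhs => simp only [h1]; rw [Finset.sum_comm]
      simp only [h1]
      rw [← Finset.sum_neg_distrib]
      refine Finset.sum_congr rfl fun k _ => ?_
      rw [← Finset.sum_neg_distrib]
      refine Finset.sum_congr rfl fun n _ => ?_
      rw [hskew, neg_smul, mul_comm]
    have h3 : rot i j K = ∑ k, (b k : Sm d) * rot i j (b k : Sm d) +
        ∑ k, (b k : Sm d) * rot i j (b k : Sm d) := by
      simp only [K, map_sum, Derivation.leibniz, smul_eq_mul, Finset.sum_add_distrib]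
    rw [h3]
    nth_rewrite 1 [h2]
    exact neg_add_cancel _
  have hK := eq_const_of_rot_eq_zero hd hrot ω
  have hint : integ K = m := by
    simp only [K, map_sum]
    have : ∀ k, integ ((b k : Sm d) * (b k : Sm d)) = 1 := fun k => by
      rw [← norm_sq_eq]
      have := b.norm_eq_one k
      rw [Submodule.coe_norm] at this
      rw [this, one_pow]
    simp [this]
  rw [hint] at hK
  rw [← hK]
  simp only [K, sum_apply, Sm.mul_apply, pow_two]

/-- Cauchy–Schwarz in an orthonormal basis, with the kernel on the diagonal equal to the dimension.
The crude exponential bound is enough against factorial decay. -/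
theorem abs_apply_le_of_mem_pol (hd : 1 ≤ d) {l : ℕ} {p : Sm d} (hp : p ∈ pol d (l + 1))
    (ω : S d) : |p ω| ≤ ((d : ℝ) + 2) ^ l * ‖p‖ := by
  set m := Module.finrank ℝ (pol d (l + 1)) with hm
  have hml : (m : ℝ) ≤ ((d : ℝ) + 2) ^ l := by exact_mod_cast finrank_pol_le d l
  let b := stdOrthonormalBasis ℝ (pol d (l + 1))
  have h1 : p ω = ∑ k, ⟪(b k : Sm d), p⟫_ℝ * (b k : Sm d) ω := by
    conv_lhs => rw [← sum_repr_pol b hp]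
    simp only [sum_apply, Sm.smul_apply]
  have h2 : ∑ k, ⟪(b k : Sm d), p⟫_ℝ ^ 2 = ‖p‖ ^ 2 := by
    have := b.sum_sq_norm_inner_right ⟨p, hp⟩
    simpa using this
  have h3 : p ω ^ 2 ≤ ‖p‖ ^ 2 * m := by
    rw [h1, ← h2, ← sum_basis_mul_self hd b ω]
    exact Finset.sum_mul_sq_le_sq_mul_sq _ _ _
  have hB : (1 : ℝ) ≤ ((d : ℝ) + 2) ^ l := one_le_pow₀ (by linarith [d.cast_nonneg (α := ℝ)])
  refine abs_le_of_sq_le_sq (h3.trans ?_) (by positivity)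
  calc ‖p‖ ^ 2 * m ≤ ‖p‖ ^ 2 * (((d : ℝ) + 2) ^ l * ((d : ℝ) + 2) ^ l) := by
        gcongr
        nlinarith
    _ = _ := by ring

/-! ### Spherical harmonics -/

/-- The defect `Lap g + eig d l • g` lies in `pol d l` by triangularity, and is orthogonal to `pol d
l` because the Laplacian is symmetric and preserves that space. It is thus orthogonal to itself. -/
theorem Lap_eq_of_orthogonal {l : ℕ} {g : Sm d} (hg : g ∈ pol d (l + 1))
    (hgo : ∀ p ∈ pol d l, ⟪g, p⟫_ℝ = 0) : Lap g = -(eig d l • g) := by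
  have hsymm : ∀ f h : Sm d, integ (Lap f * h) = integ (f * Lap h) := fun f h => by
    rw [mul_comm f, integ_Lap_mul, integ_Lap_mul]
    simp_rw [mul_comm (D _ f)]
  have hLap : ∀ p ∈ pol d l, Lap p ∈ pol d l := fun p hp => by
    cases l with
    | zero =>
      have : p = 0 := by simpa [pol] using hp
      simp [this]
    | succ l =>
      have h := sub_mem (pol_le_succ _ (Lap_add_mem_pol hp)) (Submodule.smul_mem _ (eig d l) hp)
      rwa [add_sub_cancel_right] at h
  set q := Lap g + eig d l • g with hq
  have hqm : q ∈ pol d l := Lap_add_mem_pol hg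
  have h1 : ⟪q, q⟫_ℝ = 0 := by
    have h2 : ⟪Lap g, q⟫_ℝ = 0 := by
      rw [inner_eq, hsymm, ← inner_eq]
      exact hgo _ (hLap q hqm)
    nth_rewrite 1 [hq]
    rw [inner_add_left, inner_smul_left, h2, hgo q hqm]
    simp
  exact eq_neg_of_add_eq_zero_left (inner_self_eq_zero.mp h1)

theorem sq_le_eig (hd : 1 ≤ d) (l : ℕ) : (l : ℝ) ^ 2 ≤ eig d l := by
  have : (1 : ℝ) ≤ d := by exact_mod_cast hd
  rw [eig]
  nlinarith [l.cast_nonneg (α := ℝ)]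

/-- Green's formula: `∑ ‖D i g‖² = -⟪Lap g, g⟫ = eig d l * ‖g‖²`. -/
theorem norm_D_le (hd : 1 ≤ d) {l : ℕ} {g : Sm d} (hg : g ∈ pol d (l + 1))
    (hgo : ∀ p ∈ pol d l, ⟪g, p⟫_ℝ = 0) (i : Fin (d + 1)) :
    ‖D i g‖ ≤ √(eig d l) * ‖g‖ := by
  have h0 : 0 ≤ eig d l := (sq_nonneg _).trans (sq_le_eig hd l)
  have h1 : ∑ i, ‖D i g‖ ^ 2 = eig d l * ‖g‖ ^ 2 := by
    have h2 := integ_Lap_mul g g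
    rw [Lap_eq_of_orthogonal hg hgo, neg_mul, smul_mul_assoc, map_neg, map_smul, ← norm_sq_eq,
      map_sum] at h2
    simp_rw [← norm_sq_eq, smul_eq_mul] at h2
    linarith
  have h3 : ‖D i g‖ ^ 2 ≤ eig d l * ‖g‖ ^ 2 := by
    rw [← h1]
    exact Finset.single_le_sum (f := fun i => ‖D i g‖ ^ 2) (fun i _ => sq_nonneg _)
      (Finset.mem_univ i)
  refine le_of_sq_le_sq ?_ (by positivity)
  rw [mul_pow, Real.sq_sqrt h0]
  exact h3

/-! ### Decay of the harmonic components of a stationary functional -/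

theorem exists_riesz (φ : Sm d →ₗ[ℝ] ℝ) (l : ℕ) :
    ∃ F ∈ pol d l, ∀ p ∈ pol d l, ⟪F, p⟫_ℝ = φ p := by
  let ψ : StrongDual ℝ (pol d l) := LinearMap.toContinuousLinearMap (φ ∘ₗ (pol d l).subtype)
  refine ⟨((InnerProductSpace.toDual ℝ (pol d l)).symm ψ : Sm d), Subtype.mem _, fun p hp => ?_⟩
  exact InnerProductSpace.toDual_symm_apply (x := (⟨p, hp⟩ : pol d l)) (y := ψ)

/-- The polynomial of degree less than `l` which represents a functional on these polynomials. -/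
noncomputable def riesz (φ : Sm d →ₗ[ℝ] ℝ) (l : ℕ) : Sm d := (exists_riesz φ l).choose

theorem riesz_mem (φ : Sm d →ₗ[ℝ] ℝ) (l : ℕ) : riesz φ l ∈ pol d l :=
  (exists_riesz φ l).choose_spec.1

theorem inner_riesz (φ : Sm d →ₗ[ℝ] ℝ) {l : ℕ} {p : Sm d} (hp : p ∈ pol d l) :
    ⟪riesz φ l, p⟫_ℝ = φ p :=
  (exists_riesz φ l).choose_spec.2 p hp

/-- The harmonic component of degree `l` of a functional. -/
noncomputable def harm (φ : Sm d →ₗ[ℝ] ℝ) (l : ℕ) : Sm d := riesz φ (l + 1) - riesz φ l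

theorem harm_mem (φ : Sm d →ₗ[ℝ] ℝ) (l : ℕ) : harm φ l ∈ pol d (l + 1) :=
  sub_mem (riesz_mem φ _) (pol_le_succ _ (riesz_mem φ l))

theorem inner_harm (φ : Sm d →ₗ[ℝ] ℝ) (l : ℕ) : ∀ p ∈ pol d l, ⟪harm φ l, p⟫_ℝ = 0 :=
  fun p hp => by
    rw [harm, inner_sub_left, inner_riesz φ (pol_le_succ _ hp), inner_riesz φ hp, sub_self]

theorem norm_sq_harm (φ : Sm d →ₗ[ℝ] ℝ) (l : ℕ) : ‖harm φ l‖ ^ 2 = φ (harm φ l) := by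
  rw [← inner_riesz φ (harm_mem φ l), ← real_inner_self_eq_norm_sq]
  nth_rewrite 1 [harm]
  rw [inner_sub_left, real_inner_comm _ (riesz φ l), inner_harm φ l _ (riesz_mem φ l), sub_zero]

theorem riesz_eq_sum (φ : Sm d →ₗ[ℝ] ℝ) (l : ℕ) :
    riesz φ l = ∑ j ∈ Finset.range l, harm φ j := by
  have h0 : riesz φ 0 = 0 := by
    have : riesz φ 0 ∈ (⊥ : Submodule ℝ (Sm d)) := riesz_mem φ 0
    simpa using this
  simp only [harm]
  rw [Finset.sum_range_sub, h0, sub_zero]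

/-- The derivative in the direction of the tangential part of `v`. -/
noncomputable def DJ (v : E d) : Sm d →ₗ[ℝ] Sm d := ∑ i, v i • (D i).toLinearMap

theorem DJ_apply (v : E d) (f : Sm d) : DJ v f = ∑ i, v i • D i f := by
  simp [DJ]

/-- The adjoint of `D i` is `-D i + d X i`, which raises the degree by at most one. Hence a
derivative of a harmonic has no components more than one degree below it. -/
theorem inner_DJ_harm (φ : Sm d →ₗ[ℝ] ℝ) (v : E d) {l : ℕ} {q : Sm d} (hq : q ∈ pol d l) :
    ⟪q, DJ v (harm φ (l + 1))⟫_ℝ = 0 := by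
  rw [DJ_apply, inner_sum]
  refine Finset.sum_eq_zero fun i _ => ?_
  have h1 : integ (harm φ (l + 1) * D i q) = 0 := inner_harm φ (l + 1) _ (D_mem_pol i hq)
  have h2 : integ (X i * (harm φ (l + 1) * q)) = 0 := by
    rw [mul_left_comm]
    exact inner_harm φ (l + 1) _ (X_mul_mem_pol hq i)
  rw [inner_smul_right, inner_eq, mul_comm q, integ_D_mul, h1, h2]
  simp

theorem norm_DJ_harm_le (hd : 1 ≤ d) (φ : Sm d →ₗ[ℝ] ℝ) {v : E d} (hv : ∀ i, |v i| ≤ 1) (l : ℕ) :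
    ‖DJ v (harm φ l)‖ ≤ (d + 1) * (√(eig d l) * ‖harm φ l‖) := by
  rw [DJ_apply]
  refine (norm_sum_le _ _).trans ?_
  have h : ∀ i ∈ Finset.univ, ‖v i • D i (harm φ l)‖ ≤ √(eig d l) * ‖harm φ l‖ := fun i _ => by
    rw [norm_smul]
    calc ‖v i‖ * ‖D i (harm φ l)‖ ≤ 1 * (√(eig d l) * ‖harm φ l‖) :=
          mul_le_mul (hv i) (norm_D_le hd (harm_mem φ l) (inner_harm φ l) i) (norm_nonneg _)
            zero_le_one
      _ = _ := one_mul _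
  refine (Finset.sum_le_card_nsmul _ _ _ h).trans (le_of_eq ?_)
  simp

/-- Test the equation with `g = harm φ (l + 1)`. Diffusion gives `σ s² ‖g‖²` with `s = √(eig d (l +
1))`, and the drift is at most `(d + 1) s ‖g‖` times the norms of three consecutive components.
Dividing by `s ‖g‖` leaves one factor `s ≥ l + 1`. -/
theorem norm_harm_recurrence (hd : 1 ≤ d) {σ : ℝ} (hσ : 0 < σ) {φ : Sm d →ₗ[ℝ] ℝ} {v : E d}
    (hv : ∀ i, |v i| ≤ 1) (hφ : ∀ h, σ * φ (Lap h) + φ (DJ v h) = 0) (l : ℕ) :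
    σ * (l + 1) * ‖harm φ (l + 1)‖ ≤
      (d + 1) * (‖harm φ (l + 2)‖ + ‖harm φ (l + 1)‖ + ‖harm φ l‖) := by
  set g := harm φ (l + 1) with hg
  set A := ‖harm φ (l + 2)‖ + ‖g‖ + ‖harm φ l‖ with hA
  set s := √(eig d (l + 1)) with hs
  have hsl : (l : ℝ) + 1 ≤ s := by
    refine Real.le_sqrt_of_sq_le ?_
    exact_mod_cast sq_le_eig hd (l + 1)
  have hs2 : eig d (l + 1) = s ^ 2 :=
    (Real.sq_sqrt ((sq_nonneg _).trans (sq_le_eig hd (l + 1)))).symm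
  have hl0 : (0 : ℝ) < l + 1 := by positivity
  have h1 : φ (DJ v g) = σ * (s ^ 2 * ‖g‖ ^ 2) := by
    have h2 := hφ g
    rw [Lap_eq_of_orthogonal (harm_mem φ _) (inner_harm φ _), map_neg, map_smul, ← hg,
      ← norm_sq_harm, ← hg, smul_eq_mul, hs2] at h2
    linarith
  have hDm : DJ v g ∈ pol d (l + 1 + 1 + 1) := by
    rw [DJ_apply]
    exact sum_mem fun i _ => Submodule.smul_mem _ _ (D_mem_pol i (harm_mem φ (l + 1)))
  have h3 : φ (DJ v g) = ⟪harm φ (l + 2) + g + harm φ l, DJ v g⟫_ℝ := by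
    rw [← inner_riesz φ hDm]
    have e : riesz φ (l + 1 + 1 + 1) = (harm φ (l + 2) + g + harm φ l) + riesz φ l := by
      rw [hg]; simp only [harm]; abel
    rw [e, inner_add_left _ (riesz φ l), inner_DJ_harm φ v (riesz_mem φ l), add_zero]
  have h4 : φ (DJ v g) ≤ A * ((d + 1) * (s * ‖g‖)) := by
    rw [h3]
    refine (real_inner_le_norm _ _).trans ?_
    refine mul_le_mul ?_ (norm_DJ_harm_le hd φ hv (l + 1)) (norm_nonneg _) (by positivity)
    exact (norm_add_le _ _).trans (add_le_add_left (norm_add_le _ _) _)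
  rcases (norm_nonneg g).eq_or_lt with h0 | h0
  · rw [← h0, mul_zero]; positivity
  · have hs0 : 0 < s := hl0.trans_le hsl
    have h5 : (s * ‖g‖) * (σ * s * ‖g‖) ≤ (s * ‖g‖) * ((d + 1) * A) := by
      rw [h1] at h4
      linarith
    have h6 := le_of_mul_le_mul_left h5 (mul_pos hs0 h0)
    refine le_trans ?_ h6
    gcongr

/-- A probability measure is bounded by the sup norm, so `‖harm φ l‖² = φ (harm φ l)` is at most `(d
+ 2) ^ l * ‖harm φ l‖`. -/
theorem norm_harm_le (hd : 1 ≤ d) {φ : Sm d →ₗ[ℝ] ℝ}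
    (hsup : ∀ f c, (∀ ω, |f ω| ≤ c) → φ f ≤ c) (l : ℕ) :
    ‖harm φ l‖ ≤ ((d : ℝ) + 2) ^ l := by
  have h1 := hsup (harm φ l) _ (abs_apply_le_of_mem_pol hd (harm_mem φ l))
  rw [← norm_sq_harm, pow_two] at h1
  rcases (norm_nonneg (harm φ l)).eq_or_lt with h0 | h0
  · rw [← h0]; positivity
  · exact le_of_mul_le_mul_right h1 h0

/-- The harmonic components of a stationary functional decay faster than exponentially. -/
theorem norm_harm_decay (hd : 1 ≤ d) {σ : ℝ} (hσ : 0 < σ) {φ : Sm d →ₗ[ℝ] ℝ} {v : E d}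
    (hv : ∀ i, |v i| ≤ 1) (hφ : ∀ h, σ * φ (Lap h) + φ (DJ v h) = 0)
    (hsup : ∀ f c, (∀ ω, |f ω| ≤ c) → φ f ≤ c) :
    ∃ K : ℝ, 0 ≤ K ∧ ∀ m l : ℕ, m ≤ l →
      ‖harm φ l‖ ≤ ((d : ℝ) + 2) ^ l * (K ^ m / m.factorial) := by
  set B : ℝ := (d : ℝ) + 2 with hB
  have hB1 : 1 ≤ B := by have := d.cast_nonneg (α := ℝ); linarith
  have hB0 : 0 < B := by linarith
  -- The recurrence involves the higher degree `l + 2`, so the induction is on the number `m` of its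
  -- applications, for all `l ≥ m` at once. In `K`, `3` counts the components on the right and `B`
  -- pays for the passage from `B ^ (l + 1)` to `B ^ (l + 2)`.
  refine ⟨(d + 1) / σ * (3 * B), by positivity, fun m => ?_⟩
  set K := (d + 1) / σ * (3 * B) with hK
  induction m with
  | zero => intro l _; simpa using norm_harm_le hd hsup l
  | succ m ih =>
    intro l hl
    obtain ⟨l, rfl⟩ : ∃ k, l = k + 1 := ⟨l - 1, by omega⟩
    have hml : m ≤ l := by omega
    have hrec := norm_harm_recurrence hd hσ hv hφ l
    have hK0 : 0 ≤ K ^ m / m.factorial := by positivity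
    have hp1 : B ^ (l + 1) ≤ B ^ (l + 2) := pow_le_pow_right₀ hB1 (by omega)
    have hp0 : B ^ l ≤ B ^ (l + 2) := pow_le_pow_right₀ hB1 (by omega)
    have h1 : ‖harm φ (l + 2)‖ + ‖harm φ (l + 1)‖ + ‖harm φ l‖ ≤
        3 * B ^ (l + 2) * (K ^ m / m.factorial) := by
      have a1 := ih (l + 2) (by omega)
      have a2 := (ih (l + 1) (by omega)).trans (mul_le_mul_of_nonneg_right hp1 hK0)
      have a3 := (ih l hml).trans (mul_le_mul_of_nonneg_right hp0 hK0)
      linarith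
    have h2 : σ * (l + 1) * ‖harm φ (l + 1)‖ ≤
        (d + 1) * (3 * B ^ (l + 2) * (K ^ m / m.factorial)) :=
      hrec.trans (by gcongr)
    have hm1 : σ * (m + 1) * ‖harm φ (l + 1)‖ ≤
        (d + 1) * (3 * B ^ (l + 2) * (K ^ m / m.factorial)) :=
      le_trans (by gcongr) h2
    have h3 : σ * (m + 1) * (B ^ (l + 1) * (K ^ (m + 1) / (m + 1).factorial)) =
        (d + 1) * (3 * B ^ (l + 2) * (K ^ m / m.factorial)) := by
      have hf : (m.factorial : ℝ) ≠ 0 := by positivity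
      rw [Nat.factorial_succ, pow_succ K, hK]
      push_cast
      field_simp
      ring
    rw [← h3] at hm1
    exact le_of_mul_le_mul_left hm1 (by positivity)

theorem sqrt_eig_le (l : ℕ) : √(eig d l) ≤ (d + 1) * 2 ^ l := by
  have hd0 := d.cast_nonneg (α := ℝ)
  have hl0 := l.cast_nonneg (α := ℝ)
  have h1 : √(eig d l) ≤ l + d := by
    refine Real.sqrt_le_iff.mpr ⟨by positivity, ?_⟩
    rw [eig]
    nlinarith
  have h2 : (l : ℝ) + 1 ≤ 2 ^ l := by exact_mod_cast Nat.lt_two_pow_self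
  calc √(eig d l) ≤ l + d := h1
    _ ≤ (d + 1) * (l + 1) := by nlinarith
    _ ≤ _ := by gcongr

theorem exists_summable_bound (hd : 1 ≤ d) {σ : ℝ} (hσ : 0 < σ) {φ : Sm d →ₗ[ℝ] ℝ} {v : E d}
    (hv : ∀ i, |v i| ≤ 1) (hφ : ∀ h, σ * φ (Lap h) + φ (DJ v h) = 0)
    (hsup : ∀ f c, (∀ ω, |f ω| ≤ c) → φ f ≤ c) :
    ∃ b : ℕ → ℝ, Summable b ∧ (∀ l, 0 ≤ b l) ∧ (∀ l ω, |harm φ l ω| ≤ b l) ∧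
      ∀ i l ω, |D i (harm φ l) ω| ≤ b l := by
  obtain ⟨K, hK0, hK⟩ := norm_harm_decay hd hσ hv hφ hsup
  set B : ℝ := (d : ℝ) + 2 with hB
  have hB1 : 1 ≤ B := by have := d.cast_nonneg (α := ℝ); linarith
  have hB0 : 0 < B := by linarith
  let c : ℝ := B * (d + 1)
  -- One factor `B` comes from the a priori bound, one from sup norm against `L²` norm, and `2` from
  -- `√(eig d l) ≤ (d + 1) 2 ^ l`; the decay is used with `m = l`.
  let r : ℝ := 2 * (B * B * K)
  have hval : ∀ l : ℕ, c * (r ^ l / l.factorial) =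
      B ^ (l + 1) * ((d + 1) * 2 ^ l * (B ^ l * (K ^ l / l.factorial))) := fun l => by
    simp only [c, r, mul_pow, pow_succ]; ring
  have hnn : ∀ l : ℕ, 0 ≤ B ^ l * (K ^ l / l.factorial) := fun l => by positivity
  refine ⟨fun l => c * (r ^ l / l.factorial), (Real.summable_pow_div_factorial r).mul_left c,
    fun l => by simp only [hval]; positivity, fun l ω => ?_, fun i l ω => ?_⟩
  · refine (abs_apply_le_of_mem_pol hd (harm_mem φ l) ω).trans ?_
    simp only [hval]
    refine mul_le_mul (pow_le_pow_right₀ hB1 (by omega)) ((hK l l le_rfl).trans ?_)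
      (norm_nonneg _) (by positivity)
    refine le_mul_of_one_le_left (hnn l) ?_
    have h1 : (1 : ℝ) ≤ 2 ^ l := one_le_pow₀ one_le_two
    have h2 : (1 : ℝ) ≤ d + 1 := by have := d.cast_nonneg (α := ℝ); linarith
    nlinarith
  · refine (abs_apply_le_of_mem_pol hd (D_mem_pol i (harm_mem φ l)) ω).trans ?_
    simp only [hval]
    refine mul_le_mul_of_nonneg_left ?_ (by positivity)
    refine (norm_D_le hd (harm_mem φ l) (inner_harm φ l) i).trans ?_
    exact mul_le_mul (sqrt_eig_le l) (hK l l le_rfl) (norm_nonneg _) (by positivity)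

/-! ### Regularity of stationary measures -/

/-- Smooth functions as continuous functions. -/
def toC : Sm d →ₐ[ℝ] C(S d, ℝ) where
  toFun f := ⟨f, f.continuous⟩
  map_one' := rfl
  map_mul' _ _ := rfl
  map_zero' := rfl
  map_add' _ _ := rfl
  commutes' _ := rfl

theorem toC_apply (f : Sm d) (ω : S d) : toC f ω = f ω := rfl

/-- Integration of smooth functions against a probability measure. -/
noncomputable def measFun (ν : Measure (S d)) [IsProbabilityMeasure ν] : Sm d →ₗ[ℝ] ℝ :=
  (integralCLM ν).toLinearMap ∘ₗ toC.toLinearMap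

theorem measFun_apply (ν : Measure (S d)) [IsProbabilityMeasure ν] (f : Sm d) :
    measFun ν f = ∫ ω, f ω ∂ν := rfl

theorem measFun_le (ν : Measure (S d)) [IsProbabilityMeasure ν] (f : Sm d) (c : ℝ)
    (h : ∀ ω, |f ω| ≤ c) : measFun ν f ≤ c := by
  rw [measFun_apply]
  refine (integral_mono (integrable_unif f.continuous ν) (integrable_const c)
    fun ω => (le_abs_self _).trans (h ω)).trans ?_
  simp

theorem mul_mem_pol_add {l m : ℕ} {p q : Sm d} (hp : p ∈ pol d (l + 1)) (hq : q ∈ pol d (m + 1)) :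
    p * q ∈ pol d (l + m + 1) := by
  change p * q ∈ affine d ^ (l + m)
  rw [pow_add]
  exact Submodule.mul_mem_mul hp hq

/-- Functionals on `C⁰` are determined by their values on spherical polynomials. -/
theorem clm_ext {A B : C(S d, ℝ) →L[ℝ] ℝ} (h : ∀ l, ∀ p ∈ pol d (l + 1), A (toC p) = B (toC p)) :
    A = B := by
  -- Stone–Weierstrass: the coordinates separate points and generate a dense algebra of spherical
  -- polynomials.
  let 𝒜 : Subalgebra ℝ C(S d, ℝ) := Algebra.adjoin ℝ (Set.range fun i => toC (X i))
  have hsep : 𝒜.SeparatesPoints := by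
    intro ω η hne
    have h1 : ∃ i, (ω : E d) i ≠ (η : E d) i := by
      by_contra hall
      push Not at hall
      exact hne (Subtype.ext (PiLp.ext hall))
    obtain ⟨i, hi⟩ := h1
    exact ⟨_, ⟨toC (X i), Algebra.subset_adjoin ⟨i, rfl⟩, rfl⟩, hi⟩
  have htop := ContinuousMap.subalgebra_topologicalClosure_eq_top_of_separatesPoints 𝒜 hsep
  have hpol : ∀ k ∈ 𝒜, ∃ l, ∃ p ∈ pol d (l + 1), toC p = k := by
    intro k hk
    induction hk using Algebra.adjoin_induction with
    | mem k hk =>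
      obtain ⟨i, rfl⟩ := hk
      refine ⟨1, X i, ?_, rfl⟩
      simpa using mul_X_mem_pol one_mem_pol i
    | algebraMap c => exact ⟨0, c • 1, Submodule.smul_mem _ _ one_mem_pol, by
        rw [map_smul, map_one, Algebra.algebraMap_eq_smul_one]⟩
    | add a b _ _ ha hb =>
      obtain ⟨l, p, hp, rfl⟩ := ha
      obtain ⟨m, q, hq, rfl⟩ := hb
      exact ⟨l + m, p + q, add_mem (pol_mono (by omega) hp) (pol_mono (by omega) hq),
        map_add _ _ _⟩
    | mul a b _ _ ha hb =>
      obtain ⟨l, p, hp, rfl⟩ := ha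
      obtain ⟨m, q, hq, rfl⟩ := hb
      exact ⟨l + m, p * q, mul_mem_pol_add hp hq, map_mul _ _ _⟩
  have hdense : Dense (𝒜 : Set C(S d, ℝ)) := fun k => by
    have : k ∈ 𝒜.topologicalClosure := by rw [htop]; trivial
    exact this
  refine DFunLike.coe_injective (Continuous.ext_on hdense A.continuous B.continuous fun k hk => ?_)
  obtain ⟨l, p, hp, rfl⟩ := hpol k hk
  exact h l p hp

/-- A stationary measure has a continuous density, which is the uniform limit of spherical
polynomials whose gradients converge uniformly. -/
theorem exists_continuous_density (hd : 1 ≤ d) {σ : ℝ} (hσ : 0 < σ) (ν : Measure (S d))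
    [IsProbabilityMeasure ν] {v : E d} (hv : ∀ i, |v i| ≤ 1)
    (hφ : ∀ h, σ * measFun ν (Lap h) + measFun ν (DJ v h) = 0) :
    ∃ (q : ℕ → Sm d) (f : C(S d, ℝ)) (G : Fin (d + 1) → C(S d, ℝ)),
      Tendsto (fun n => toC (q n)) atTop (nhds f) ∧
      (∀ i, Tendsto (fun n => toC (D i (q n))) atTop (nhds (G i))) ∧
      integralCLM ν = mulIntegralCLM f := by
  set φ := measFun ν with hφdef
  obtain ⟨b, hb, hb0, hb1, hb2⟩ := exists_summable_bound hd hσ hv hφ (measFun_le ν)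
  have hs1 : Summable fun l => toC (harm φ l) :=
    Summable.of_norm_bounded hb fun l => (ContinuousMap.norm_le _ (hb0 l)).mpr (hb1 l)
  have hs2 : ∀ i, Summable fun l => toC (D i (harm φ l)) := fun i =>
    Summable.of_norm_bounded hb fun l => (ContinuousMap.norm_le _ (hb0 l)).mpr (hb2 i l)
  have ht1 : Tendsto (fun n => toC (riesz φ n)) atTop (nhds (∑' l, toC (harm φ l))) := by
    simp_rw [riesz_eq_sum, map_sum]
    exact hs1.hasSum.tendsto_sum_nat
  refine ⟨riesz φ, ∑' l, toC (harm φ l), fun i => ∑' l, toC (D i (harm φ l)), ht1, fun i => ?_,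
    clm_ext fun l p hp => ?_⟩
  · simp_rw [riesz_eq_sum, map_sum]
    exact (hs2 i).hasSum.tendsto_sum_nat
  · have h1 : Tendsto (fun n => integralCLM (unif d) (toC (riesz φ n) * toC p)) atTop
        (nhds (integralCLM (unif d) ((∑' l, toC (harm φ l)) * toC p))) :=
      ((integralCLM (unif d)).continuous.tendsto _).comp (ht1.mul_const _)
    -- Against a fixed polynomial the partial sums reproduce `ν` exactly once `n` exceeds its
    -- degree.
    have h2 : ∀ᶠ n in atTop, integralCLM (unif d) (toC (riesz φ n) * toC p) =
        integralCLM ν (toC p) := by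
      filter_upwards [eventually_ge_atTop (l + 1)] with n hn
      exact inner_riesz φ (pol_mono hn hp)
    exact tendsto_nhds_unique (tendsto_const_nhds.congr' (h2.mono fun _ h => h.symm)) h1

/-- The exponential `exp (ω · v / c)`. -/
noncomputable def expS (v : E d) (c : ℝ) : Sm d :=
  ⟨fun ω => Real.exp ((0 + ⟪(ω : E d), v⟫_ℝ) / c), isC_exp_inner ⊤ v 0 c⟩

theorem expS_apply (v : E d) (c : ℝ) (ω : S d) :
    expS v c ω = Real.exp ((0 + ⟪(ω : E d), v⟫_ℝ) / c) := rfl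

/-- The gradient of the exponential is `c⁻¹` times itself times the tangential part of `v`, whose
normal part is invisible to `∇h`. -/
theorem sum_D_mul_D_expS (v : E d) (c : ℝ) (h : Sm d) :
    ∑ i, D i h * D i (expS v c) = c⁻¹ • (expS v c * DJ v h) := by
  refine Sm.ext fun ω => ?_
  have h0 := sum_coord_mul_pd (h.diffAt ω)
  have h1 : ∀ i, (D i h * D i (expS v c)) ω = c⁻¹ * expS v c ω * (v i * D i h ω) -
      c⁻¹ * expS v c ω * ⟪(ω : E d), v⟫_ℝ * (coord i ω * pd i h ω) := fun i => by
    have h2 : D i (expS v c) ω = c⁻¹ * (expS v c ω * tangProj ω v i) := pd_exp_inner v 0 c i ω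
    rw [Sm.mul_apply, h2, tangProj_apply, D_apply]
    ring
  rw [sum_apply, Finset.sum_congr rfl fun i _ => h1 i, Finset.sum_sub_distrib, ← Finset.mul_sum,
    ← Finset.mul_sum, h0, Sm.smul_apply, Sm.mul_apply, DJ_apply, sum_apply]
  simp only [Sm.smul_apply]
  ring

/-- The generator is symmetric with respect to the measure of density `exp (ω · v / σ)`. -/
theorem integ_generator_mul {σ : ℝ} (hσ : 0 < σ) (v : E d) (h u : Sm d) :
    integ ((σ • Lap h + DJ v h) * (expS v σ * u)) =
      -(σ * integ (expS v σ * ∑ i, D i u * D i h)) := by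
  have h1 := integ_Lap_mul h (expS v σ * u)
  have h2 : ∑ i, D i h * D i (expS v σ * u) =
      expS v σ * ∑ i, D i u * D i h + u * ∑ i, D i h * D i (expS v σ) := by
    rw [Finset.mul_sum, Finset.mul_sum, ← Finset.sum_add_distrib]
    exact Finset.sum_congr rfl fun i _ => by rw [D_mul]; ring
  have h3 : DJ v h * (expS v σ * u) = u * (expS v σ * DJ v h) := by ring
  rw [h2, sum_D_mul_D_expS, map_add, mul_smul_comm, map_smul, smul_eq_mul] at h1
  rw [add_mul, smul_mul_assoc, map_add, map_smul, h1, h3, smul_eq_mul]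
  field_simp
  ring

theorem expS_mul_expS_neg (v : E d) (σ : ℝ) : expS v σ * expS v (-σ) = 1 := by
  refine Sm.ext fun ω => ?_
  rw [Sm.mul_apply, expS_apply, expS_apply, ← Real.exp_add, Sm.one_apply, div_neg, add_neg_cancel,
    Real.exp_zero]

/-- The density of a stationary measure is proportional to `exp (ω · v / σ)`. -/
theorem exists_density_eq_exp (hd : 1 ≤ d) {σ : ℝ} (hσ : 0 < σ) (ν : Measure (S d))
    [IsProbabilityMeasure ν] {v : E d} (hv : ∀ i, |v i| ≤ 1)
    (hφ : ∀ h, σ * measFun ν (Lap h) + measFun ν (DJ v h) = 0) :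
    ∃ c : ℝ, integralCLM ν = mulIntegralCLM (c • toC (expS v σ)) := by
  obtain ⟨q, f, G, hq, hG, hν⟩ := exists_continuous_density hd hσ ν hv hφ
  set M := expS v σ with hM
  set W := expS v (-σ) with hW
  have hMW : M * W = 1 := expS_mul_expS_neg v σ
  let u : ℕ → Sm d := fun n => W * q n
  have hMu : ∀ n, M * u n = q n := fun n => by rw [← mul_assoc, hMW, one_mul]
  let H : Fin (d + 1) → C(S d, ℝ) := fun i => toC W * G i + f * toC (D i W)
  have hu : ∀ i, Tendsto (fun n => toC (D i (u n))) atTop (nhds (H i)) := fun i => by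
    have h1 : ∀ n, toC (D i (u n)) = toC W * toC (D i (q n)) + toC (q n) * toC (D i W) := fun n => by
      rw [D_mul, map_add, map_mul, map_mul]
    simp_rw [h1]
    exact ((hG i).const_mul _).add (hq.mul_const _)
  have hI : Continuous (integralCLM (unif d)) := (integralCLM (unif d)).continuous
  -- `H` plays the role of the gradient of `u = f / M`. The identity is proved for the smooth `u n`
  -- and passed to the limit, so no derivative of `f` is needed.
  have hweak : ∀ h : Sm d, integralCLM (unif d) (toC M * ∑ i, H i * toC (D i h)) = 0 := fun h => by
    have h1 : Tendsto (fun n => integralCLM (unif d) (toC M * ∑ i, toC (D i (u n)) * toC (D i h)))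
        atTop (nhds (integralCLM (unif d) (toC M * ∑ i, H i * toC (D i h)))) :=
      (hI.tendsto _).comp
        ((tendsto_finsetSum _ fun i _ => (hu i).mul_const _).const_mul _)
    have h2 : Tendsto (fun n => integralCLM (unif d) (toC (q n) * toC (σ • Lap h + DJ v h)))
        atTop (nhds (integralCLM (unif d) (f * toC (σ • Lap h + DJ v h)))) :=
      (hI.tendsto _).comp (hq.mul_const _)
    have h3 : integralCLM (unif d) (f * toC (σ • Lap h + DJ v h)) = 0 := by
      have h4 := DFunLike.congr_fun hν (toC (σ • Lap h + DJ v h))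
      have h5 : measFun ν (σ • Lap h + DJ v h) = 0 := by
        rw [map_add, map_smul]; exact hφ h
      exact h4.symm.trans h5
    have h6 : ∀ n, integralCLM (unif d) (toC (q n) * toC (σ • Lap h + DJ v h)) =
        -σ * integralCLM (unif d) (toC M * ∑ i, toC (D i (u n)) * toC (D i h)) := fun n => by
      have h7 := integ_generator_mul hσ v h (u n)
      rw [← hM, hMu] at h7
      simp_rw [← map_mul, ← map_sum, ← map_mul]
      rw [mul_comm (q n), neg_mul]
      exact h7
    simp_rw [h6] at h2
    have h8 := tendsto_nhds_unique h2 (h1.const_mul (-σ))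
    rw [h3] at h8
    exact (mul_eq_zero.mp h8.symm).resolve_left (neg_ne_zero.mpr hσ.ne')
  -- Take `h = u n` as test function and let `n` tend to infinity: `∫ M |H|² = 0`.
  have hH : ∀ i, H i = 0 := by
    have h1 : Tendsto (fun n => integralCLM (unif d) (toC M * ∑ i, H i * toC (D i (u n)))) atTop
        (nhds (integralCLM (unif d) (toC M * ∑ i, H i * H i))) :=
      (hI.tendsto _).comp
        ((tendsto_finsetSum _ fun i _ => (hu i).const_mul _).const_mul _)
    simp_rw [hweak] at h1
    have h2 : integralCLM (unif d) (toC M * ∑ i, H i * H i) = 0 :=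
      tendsto_nhds_unique h1 tendsto_const_nhds
    have hMpos : ∀ ω, 0 < M ω := fun ω => Real.exp_pos _
    have hval : ∀ ω, (toC M * ∑ i, H i * H i) ω = M ω * ∑ i, H i ω * H i ω := fun ω => by
      simp [toC_apply]
    have h3 := eq_zero_of_integral_eq_zero (toC M * ∑ i, H i * H i).continuous (fun ω => by
      rw [hval]
      exact mul_nonneg (hMpos ω).le (Finset.sum_nonneg fun i _ => mul_self_nonneg _)) h2
    intro i
    ext ω
    have h4 := congrFun h3 ω
    rw [hval] at h4
    have h5 := (mul_eq_zero.mp h4).resolve_left (hMpos ω).ne'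
    exact mul_self_eq_zero.mp
      ((Finset.sum_eq_zero_iff_of_nonneg fun i _ => mul_self_nonneg _).mp h5 i (Finset.mem_univ i))
  have hconst := exists_const_of_tendsto hd (u := fun n => u n) (f := toC W * f)
    (fun n ω => (u n).diffAt ω)
    (fun ε hε => by
      have h1 : Tendsto (fun n => ∑ i, ‖toC (D i (u n))‖) atTop (nhds (∑ i, ‖H i‖)) :=
        tendsto_finsetSum _ fun i _ => (hu i).norm
      simp only [hH, norm_zero, Finset.sum_const_zero] at h1
      filter_upwards [h1.eventually_le_const hε] with n hn ω
      exact (Finset.sum_le_sum fun i _ => (toC (D i (u n))).norm_coe_le_norm ω).trans hn)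
    (fun ω => by
      have h1 : Tendsto (fun n => toC (u n)) atTop (nhds (toC W * f)) := by
        simp only [u, map_mul]
        exact hq.const_mul _
      exact ((continuous_eval_const ω).tendsto _).comp h1)
  let ω₀ : S d := toS (EuclideanSpace.single 0 1) (by simp)
  refine ⟨W ω₀ * f ω₀, ?_⟩
  have hf : f = (W ω₀ * f ω₀) • toC M := by
    ext ω
    have h1 : W ω * f ω = W ω₀ * f ω₀ := hconst ω ω₀
    have h2 : M ω * W ω = 1 := DFunLike.congr_fun hMW ω
    rw [← h1, ContinuousMap.smul_apply, smul_eq_mul, toC_apply]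
    linear_combination -f ω * h2
  rw [← hf]
  exact hν

theorem abs_JMeas_le (ν : Measure (S d)) [IsProbabilityMeasure ν] (i : Fin (d + 1)) :
    |JMeas ν i| ≤ 1 := by
  have h1 : ‖JMeas ν‖ ≤ 1 := by
    have := norm_integral_le_of_norm_le_const (μ := ν) (f := fun ω : S d => (ω : E d))
      (C := 1) (.of_forall fun ω => (norm_coe_S ω).le)
    simpa [JMeas] using this
  exact (PiLp.norm_apply_le _ i).trans h1

theorem weakRhs_eq (σ : ℝ) (ν : Measure (S d)) [IsProbabilityMeasure ν] (h : Sm d) :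
    weakRhs σ ν h = σ * measFun ν (Lap h) + measFun ν (DJ (JMeas ν) h) := by
  rw [weakRhs, measFun_apply, measFun_apply]
  congr 2
  · exact integral_congr_ae (.of_forall fun ω => sphLaplacian_eq_Lap h ω)
  · ext ω
    rw [inner_sphGrad, DJ_apply, sum_apply]
    rfl

/-- Stationary measures have a positive density with constant chemical potential. -/
theorem exists_chemPot_eq_of_steady (hd : 1 ≤ d) {σ : ℝ} (hσ : 0 < σ) {ν : Measure (S d)}
    [IsProbabilityMeasure ν] (h : ∀ h : S d → ℝ, IsC ⊤ h → weakRhs σ ν h = 0) :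
    ∃ f : S d → ℝ, IsDensity f ν ∧ (∀ ω, 0 < f ω) ∧ ∃ C : ℝ, ∀ ω, chemPot σ f ω = C := by
  set v := JMeas ν with hv
  obtain ⟨c, hc⟩ := exists_density_eq_exp hd hσ ν (abs_JMeas_le ν)
    fun k => by rw [← weakRhs_eq]; exact h k k.isC
  set M := expS v σ with hM
  have hMpos : ∀ ω, 0 < M ω := fun ω => Real.exp_pos _
  have hint : ∀ k : C(S d, ℝ), ∫ ω, k ω ∂ν = ∫ ω, c * M ω * k ω ∂(unif d) := fun k =>
    DFunLike.congr_fun hc k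
  -- The total mass of `ν` gives `1 = c ∫ M`, which fixes the sign of `c`.
  have hcpos : 0 < c := by
    have h1 := hint 1
    simp only [ContinuousMap.one_apply, mul_one] at h1
    rw [integral_const_mul] at h1
    have h2 : 0 ≤ ∫ ω, M ω ∂(unif d) := integral_nonneg fun ω => (hMpos ω).le
    refine pos_of_mul_pos_left (b := ∫ ω, M ω ∂(unif d)) ?_ h2
    rw [← h1]
    simp
  let f : S d → ℝ := fun ω => c * M ω
  have hfpos : ∀ ω, 0 < f ω := fun ω => mul_pos hcpos (hMpos ω)
  have hfm : Measurable f := (M.continuous.measurable).const_mul c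
  have hfin : IsFiniteMeasure ((unif d).withDensity fun ω => ENNReal.ofReal (f ω)) :=
    isFiniteMeasure_withDensity_ofReal
      (integrable_unif (continuous_const.mul M.continuous) (unif d)).2
  have hdens : IsDensity f ν := by
    refine ⟨hfm, fun ω => (hfpos ω).le, ?_⟩
    refine ext_of_forall_integral_eq_of_IsFiniteMeasure fun k => ?_
    rw [integral_withDensity_eq_integral_toReal_smul hfm.ennreal_ofReal
      (.of_forall fun _ => ENNReal.ofReal_lt_top)]
    simp only [ENNReal.toReal_ofReal (hfpos _).le, smul_eq_mul]
    exact hint k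
  refine ⟨f, hdens, hfpos, σ * Real.log c, fun ω => ?_⟩
  -- The frozen vector `v` is the moment of `ν`, hence of its density: this closes the nonlinear
  -- equation.
  rw [chemPot, ← hdens.JMeas_eq, ← hv]
  simp only [f]
  rw [Real.log_mul hcpos.ne' (hMpos ω).ne', hM, expS_apply, Real.log_exp]
  field_simp
  ring

end Doi

/-! ### The equivalences -/

theorem mainTheorem10 (d : ℕ) (hd : 1 ≤ d) (σ : ℝ) (hσ : 0 < σ)
    (ν : MeasureTheory.Measure (Doi.S d)) (hν : MeasureTheory.IsProbabilityMeasure ν) :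
    List.TFAE [
      Doi.IsSteadyState σ ν,
      ∃ f : Doi.S d → ℝ, Doi.IsDensity f ν ∧ Doi.IsC 2 f ∧ ∀ ω, Doi.Q σ f ω = 0,
      ∃ f : Doi.S d → ℝ, Doi.IsDensity f ν ∧ Doi.IsC 1 f ∧ Doi.dissipation σ f = 0,
      ∃ f : Doi.S d → ℝ, Doi.IsDensity f ν ∧ Continuous f ∧ (∀ ω, 0 < f ω) ∧
        Doi.IsConstrainedCritical σ f,
      ∃ f : Doi.S d → ℝ, Doi.IsDensity f ν ∧ (∀ ω, 0 < f ω) ∧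
        ∃ C : ℝ, ∀ ω, Doi.chemPot σ f ω = C] := by
  tfae_have 1 → 5 := fun h =>
    Doi.exists_chemPot_eq_of_steady hd hσ (Doi.isSteadyState_iff.mp h)
  tfae_have 5 → 2 := fun ⟨f, hf, hpos, _, hC⟩ => ⟨f, hf, Doi.Q_eq_zero_of_chemPot_eq hσ hpos hC⟩
  tfae_have 2 → 1 := fun ⟨_, hf, hC, hQ⟩ =>
    Doi.isSteadyState_iff.mpr fun _ hh => Doi.weakRhs_eq_zero_of_Q_eq_zero hf hC hQ hh
  tfae_have 5 → 3 := fun ⟨f, hf, hpos, _, hC⟩ =>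
    ⟨f, hf, (Doi.Q_eq_zero_of_chemPot_eq hσ hpos hC).1.of_le (by norm_num),
      Doi.dissipation_eq_zero_of_chemPot_eq hC⟩
  tfae_have 3 → 5 := fun ⟨f, hf, hC, hD⟩ =>
    ⟨f, hf, Doi.exists_chemPot_eq_of_dissipation_eq_zero hd hσ hC hf.2.1 hf.integral_eq_one hD⟩
  tfae_have 5 → 4 := fun ⟨f, hf, hpos, hC⟩ =>
    have hc : Continuous f := (Doi.Q_eq_zero_of_chemPot_eq hσ hpos hC.choose_spec).1.continuous
    ⟨f, hf, hc, hpos, (Doi.isConstrainedCritical_iff hσ hc hpos hf.integral_eq_one).mpr hC⟩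
  tfae_have 4 → 5 := fun ⟨f, hf, hc, hpos, hcrit⟩ =>
    ⟨f, hf, hpos, (Doi.isConstrainedCritical_iff hσ hc hpos hf.integral_eq_one).mp hcrit⟩
  tfae_finish
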